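/- Let $A$ be an associative ring with unit which is left coherent, i.e., every finitely generated submodule of a finitely presented left $A$-module is finitely presented. A left $A$-module $J$ is called fp-injective if the functor $\operatorname{Hom}_A(-,J)$ takes short exact sequences of finitely presented left $A$-modules to short exact sequences of abelian groups. Let $A\text{-}\mathrm{mod}$ be the abelian category of left $A$-modules and $A\text{-}\mathrm{mod}_{\mathrm{fpi}}$ its full subcategory of fp-injective modules, with the inherited exact structure: its admissible short exact sequences are the short exact sequences of $A$-modules with fp-injective terms. For an exact category $\mathsf E$ with exact infinite direct sums, let $\mathrm{Hot}(\mathsf E)$ be the homotopy category of unbounded complexes over $\mathsf E$. A complex over $\mathsf E$ is called coacyclic if it belongs to the minimal triangulated subcategory of $\mathrm{Hot}(\mathsf E)$ which contains the total complexes of all (termwise admissible) short exact sequences $0\to K^\bullet\to L^\bullet\to M^\bullet\to 0$ of complexes over $\mathsf E$ and which is closed under infinite direct sums. The coderived category $\mathsf D^{\mathrm{co}}(\mathsf E)$ is the triangulated quotient category of $\mathrm{Hot}(\mathsf E)$ by the coacyclic complexes. Then the functor $$\mathsf D^{\mathrm{co}}(A\text{-}\mathrm{mod}_{\mathrm{fpi}})\longrightarrow\mathsf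 D^{\mathrm{co}}(A\text{-}\mathrm{mod})$$ induced by the inclusion $A\text{-}\mathrm{mod}_{\mathrm{fpi}}\to A\text{-}\mathrm{mod}$ is a triangulated functor and an equivalence of categories, i.e., it is an equivalence of triangulated categories. -/

import Mathlib

open CategoryTheory Limits Pretriangulated

universe u

noncomputable section

namespace Coderived

section General

universe v u₁ u₂

variable {E : Type u₁} [Category.{v} E] [Preadditive E] [HasZeroObject E] [HasBinaryBiproducts E]
  {E' : Type u₂} [Category.{v} E'] [Preadditive E'] [HasZeroObject E'] [HasBinaryBiproducts E']

/-- The homotopy category `Hot(E)` of unbounded complexes over an additive category `E`. -/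
abbrev Hot (E : Type u₁) [Category.{v} E] [Preadditive E] :=
  HomotopyCategory E (ComplexShape.up ℤ)

/-- The canonical morphism from the cone of `K ⟶ L` to `M`, for a short complex
`K ⟶ L ⟶ M` of complexes: it is zero on `K[1]`, and the given morphism on `L`. -/
def coneDesc (S : ShortComplex (CochainComplex E ℤ)) :
    CochainComplex.mappingCone S.f ⟶ S.X₃ :=
  CochainComplex.mappingCone.desc S.f 0 S.g (by simp)

/-- The total complex of the bicomplex with the three rows `K ⟶ L ⟶ M` (with `M` in degree `0`),
written as an iterated cone: in degree `n` it is `(Kⁿ⁺² ⊕ Lⁿ⁺¹) ⊕ Mⁿ`. -/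
def totalization (S : ShortComplex (CochainComplex E ℤ)) : CochainComplex E ℤ :=
  CochainComplex.mappingCone (coneDesc S)

/-- A strictly full triangulated subcategory of `Hot(E)` which contains the total complexes of
all the short exact sequences of complexes over `E` and which is closed under infinite direct
sums. Here `conf` is the class of admissible short exact sequences of the exact category `E`; a
short sequence of complexes is exact when it is so in every degree. -/
structure IsCoacyclicClass (conf : ObjectProperty (ShortComplex E))
    (P : ObjectProperty (Hot E)) : Prop where
  isTriangulated : P.IsTriangulated
  isClosedUnderIsomorphisms : P.IsClosedUnderIsomorphisms
  totalization_mem (S : ShortComplex (CochainComplex E ℤ))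
    (hS : ∀ n : ℤ, conf (S.map (HomologicalComplex.eval E (ComplexShape.up ℤ) n))) :
    P ((HomotopyCategory.quotient E (ComplexShape.up ℤ)).obj (totalization S))
  directSum_mem {ι : Type v} (K : ι → CochainComplex E ℤ) (c : Cofan K) (hc : IsColimit c)
    (hK : ∀ i, P ((HomotopyCategory.quotient E (ComplexShape.up ℤ)).obj (K i))) :
    P ((HomotopyCategory.quotient E (ComplexShape.up ℤ)).obj c.pt)

/-- The coacyclic complexes over the exact category `(E, conf)`: the minimal triangulated
subcategory of `Hot(E)` which contains the total complexes of the short exact sequences of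
complexes and which is closed under infinite direct sums. -/
def coacyclic (conf : ObjectProperty (ShortComplex E)) : ObjectProperty (Hot E) :=
  fun X => ∀ P : ObjectProperty (Hot E), IsCoacyclicClass conf P → P X

instance (conf : ObjectProperty (ShortComplex E)) :
    (coacyclic conf).IsClosedUnderIsomorphisms where
  of_iso e h P hP := by
    have := hP.isClosedUnderIsomorphisms
    exact P.prop_of_iso e (h P hP)

instance (conf : ObjectProperty (ShortComplex E)) : (coacyclic conf).IsTriangulated where
  exists_zero := ⟨_, isZero_zero _, fun P hP => by
    have := hP.isClosedUnderIsomorphisms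
    have := hP.isTriangulated
    exact P.prop_of_isZero (isZero_zero _)⟩
  isStableUnderShiftBy n := ⟨fun X hX P hP => by
    have := hP.isTriangulated
    exact P.le_shift n _ (hX P hP)⟩
  toIsTriangulatedClosed₂ := .mk' (fun T hT h₁ h₃ P hP => by
    have := hP.isClosedUnderIsomorphisms
    have := hP.isTriangulated
    exact P.ext_of_isTriangulatedClosed₂ T hT (h₁ P hP) (h₃ P hP))

lemma isCoacyclicClass_coacyclic (conf : ObjectProperty (ShortComplex E)) :
    IsCoacyclicClass conf (coacyclic conf) where
  isTriangulated := inferInstance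
  isClosedUnderIsomorphisms := inferInstance
  totalization_mem S hS _ hP := hP.totalization_mem S hS
  directSum_mem K c hc hK P hP := hP.directSum_mem K c hc (fun i => hK i P hP)

/-- The coderived category `D^co(E)` of the exact category `(E, conf)`: the triangulated quotient
category of `Hot(E)` by the coacyclic complexes, that is, the localization of `Hot(E)` at the
morphisms with a coacyclic cone. Its triangulated structure is the one of Mathlib's
`Triangulated.Localization`. -/
abbrev CoderivedCategory (conf : ObjectProperty (ShortComplex E)) :=
  (coacyclic conf).trW.Localization

section Functoriality

variable (G : E ⥤ E') [G.Additive]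

lemma mapIso_desc {K L M : CochainComplex E ℤ} (f : K ⟶ L) (g : L ⟶ M) (w : f ≫ g = 0)
    (w' : (G.mapHomologicalComplex (ComplexShape.up ℤ)).map f ≫
      (G.mapHomologicalComplex (ComplexShape.up ℤ)).map g = 0) :
    (CochainComplex.mappingCone.mapHomologicalComplexIso f G).hom ≫
      CochainComplex.mappingCone.desc ((G.mapHomologicalComplex (ComplexShape.up ℤ)).map f) 0
        ((G.mapHomologicalComplex (ComplexShape.up ℤ)).map g) (by simp [w']) =
    (G.mapHomologicalComplex (ComplexShape.up ℤ)).map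
      (CochainComplex.mappingCone.desc f 0 g (by simp [w])) := by
  symm
  ext n
  rw [HomologicalComplex.comp_f]
  simp [CochainComplex.mappingCone.mapHomologicalComplexIso,
    CochainComplex.mappingCone.mapHomologicalComplexXIso,
    CochainComplex.mappingCone.mapHomologicalComplexXIso'_hom,
    Functor.mapHomologicalComplex_map_f,
    CochainComplex.mappingCone.desc_f _ _ _ _ n (n + 1) rfl]
  have aux {X Y Y' Z T : E'} (a : X ⟶ Y) (i : Y ⟶ Z) (b : X ⟶ Y') (j : Y' ⟶ Z) (s : Z ⟶ Y')
      (t : Y' ⟶ T) (h : i ≫ s = 0) (h' : j ≫ s = 𝟙 _) : b ≫ t = (a ≫ i + b ≫ j) ≫ s ≫ t := by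
    simp [reassoc_of% h, reassoc_of% h']
  exact aux _ _ _ _ _ _ (CochainComplex.mappingCone.inl_v_snd_v _ _ _ _)
    (CochainComplex.mappingCone.inr_f_snd_v _ _)

lemma mapIso_coneDesc (S : ShortComplex (CochainComplex E ℤ)) :
    (CochainComplex.mappingCone.mapHomologicalComplexIso S.f G).hom ≫
      coneDesc (S.map (G.mapHomologicalComplex (ComplexShape.up ℤ))) =
    (G.mapHomologicalComplex (ComplexShape.up ℤ)).map (coneDesc S) :=
  mapIso_desc G S.f S.g S.zero (S.map (G.mapHomologicalComplex (ComplexShape.up ℤ))).zero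

/-- An additive functor commutes with the total complexes of short complexes of complexes. -/
lemma map_totalization_iso (S : ShortComplex (CochainComplex E ℤ)) :
    Nonempty ((G.mapHomotopyCategory (ComplexShape.up ℤ)).obj
        ((HomotopyCategory.quotient E (ComplexShape.up ℤ)).obj (totalization S)) ≅
      (HomotopyCategory.quotient E' (ComplexShape.up ℤ)).obj
        (totalization (S.map (G.mapHomologicalComplex (ComplexShape.up ℤ))))) := by
  have hT := HomotopyCategory.mappingCone_triangleh_distinguished
    ((G.mapHomologicalComplex (ComplexShape.up ℤ)).map (coneDesc S))
  have hT' := HomotopyCategory.mappingCone_triangleh_distinguished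
    (coneDesc (S.map (G.mapHomologicalComplex (ComplexShape.up ℤ))))
  let Q := HomotopyCategory.quotient E' (ComplexShape.up ℤ)
  let e₁ := Q.mapIso (CochainComplex.mappingCone.mapHomologicalComplexIso S.f G)
  let e := isoTriangleOfIso₁₂ _ _ hT hT' e₁ (Iso.refl _) (by
    have := congrArg Q.map (mapIso_coneDesc G S)
    exact (Category.comp_id _).trans (this.symm.trans (Q.map_comp _ _)))
  exact ⟨Q.mapIso (CochainComplex.mappingCone.mapHomologicalComplexIso (coneDesc S) G) ≪≫
    Triangle.π₃.mapIso e⟩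

variable {conf : ObjectProperty (ShortComplex E)} {conf' : ObjectProperty (ShortComplex E')}

/-- An additive functor which is exact and which preserves infinite direct sums
takes coacyclic complexes to coacyclic complexes. -/
lemma coacyclic_le_inverseImage (hG : ∀ S : ShortComplex E, conf S → conf' (S.map G))
    [HasCoproducts.{v} E] [∀ J : Type v, PreservesColimitsOfShape (Discrete J) G] :
    coacyclic conf ≤
      (coacyclic conf').inverseImage (G.mapHomotopyCategory (ComplexShape.up ℤ)) := by
  intro X hX
  refine hX _ ⟨inferInstance, inferInstance, fun S hS => ?_, fun {ι} K c hc hK => ?_⟩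
  · exact (coacyclic conf').prop_of_iso (map_totalization_iso G S).some.symm
      ((isCoacyclicClass_coacyclic conf').totalization_mem _ (fun n => hG _ (hS n)))
  · have : PreservesColimitsOfShape (Discrete ι)
        (G.mapHomologicalComplex (ComplexShape.up ℤ)) :=
      HomologicalComplex.preservesColimitsOfShape_of_eval _ (fun n =>
        inferInstanceAs (PreservesColimitsOfShape (Discrete ι)
          (HomologicalComplex.eval E (ComplexShape.up ℤ) n ⋙ G)))
    exact (isCoacyclicClass_coacyclic conf').directSum_mem _ _
      (isColimitCofanMkObjOfIsColimit (G.mapHomologicalComplex (ComplexShape.up ℤ)) K c.inj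
        (hc.ofIsoColimit (Cofan.ext (Iso.refl _)))) hK

/-- An exact functor preserving infinite direct sums, as a functor on the homotopy categories
that takes morphisms with a coacyclic cone to morphisms with a coacyclic cone. -/
def coderivedLocalizerMorphism (hG : ∀ S : ShortComplex E, conf S → conf' (S.map G))
    [HasCoproducts.{v} E] [∀ J : Type v, PreservesColimitsOfShape (Discrete J) G] :
    LocalizerMorphism (coacyclic conf).trW (coacyclic conf').trW where
  functor := G.mapHomotopyCategory (ComplexShape.up ℤ)
  map X Y f hf := by
    have h := ObjectProperty.trW_monotone (coacyclic_le_inverseImage G hG) _ hf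
    exact ((coacyclic conf').inverseImage_trW_iff _ f).1 h

instance (hG : ∀ S : ShortComplex E, conf S → conf' (S.map G))
    [HasCoproducts.{v} E] [∀ J : Type v, PreservesColimitsOfShape (Discrete J) G] :
    (coderivedLocalizerMorphism G hG).functor.CommShift ℤ :=
  inferInstanceAs ((G.mapHomotopyCategory (ComplexShape.up ℤ)).CommShift ℤ)

instance (hG : ∀ S : ShortComplex E, conf S → conf' (S.map G))
    [HasCoproducts.{v} E] [∀ J : Type v, PreservesColimitsOfShape (Discrete J) G] :
    (coderivedLocalizerMorphism G hG).functor.IsTriangulated :=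
  inferInstanceAs ((G.mapHomotopyCategory (ComplexShape.up ℤ)).IsTriangulated)

/-- The functor `D^co(E) ⥤ D^co(E')` induced by an exact functor `G : E ⥤ E'` preserving infinite
direct sums: it is the factorization of `Hot(E) ⥤ Hot(E') ⥤ D^co(E')` through `D^co(E)`. -/
def coderivedFunctor (hG : ∀ S : ShortComplex E, conf S → conf' (S.map G))
    [HasCoproducts.{v} E] [∀ J : Type v, PreservesColimitsOfShape (Discrete J) G] :
    CoderivedCategory conf ⥤ CoderivedCategory conf' :=
  (coderivedLocalizerMorphism G hG).localizedFunctor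
    (coacyclic conf).trW.Q (coacyclic conf').trW.Q

instance (hG : ∀ S : ShortComplex E, conf S → conf' (S.map G))
    [HasCoproducts.{v} E] [∀ J : Type v, PreservesColimitsOfShape (Discrete J) G] :
    (coderivedFunctor G hG).CommShift ℤ :=
  inferInstanceAs (((coderivedLocalizerMorphism G hG).localizedFunctor
    (coacyclic conf).trW.Q (coacyclic conf').trW.Q).CommShift ℤ)

/-- The square formed by `Hot(E) ⥤ Hot(E')`, the induced functor `D^co(E) ⥤ D^co(E')` and the
localization functors commutes. -/
def coderivedFunctorFactors (hG : ∀ S : ShortComplex E, conf S → conf' (S.map G))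
    [HasCoproducts.{v} E] [∀ J : Type v, PreservesColimitsOfShape (Discrete J) G] :
    (coacyclic conf).trW.Q ⋙ coderivedFunctor G hG ≅
      G.mapHomotopyCategory (ComplexShape.up ℤ) ⋙ (coacyclic conf').trW.Q :=
  (CatCommSq.iso (coderivedLocalizerMorphism G hG).functor (coacyclic conf).trW.Q
    (coacyclic conf').trW.Q ((coderivedLocalizerMorphism G hG).localizedFunctor
      (coacyclic conf).trW.Q (coacyclic conf').trW.Q)).symm

instance (hG : ∀ S : ShortComplex E, conf S → conf' (S.map G))
    [HasCoproducts.{v} E] [∀ J : Type v, PreservesColimitsOfShape (Discrete J) G] :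
    NatTrans.CommShift (coderivedFunctorFactors G hG).hom ℤ :=
  inferInstanceAs (NatTrans.CommShift (CatCommSq.iso (coderivedLocalizerMorphism G hG).functor
    (coacyclic conf).trW.Q (coacyclic conf').trW.Q
    ((coderivedLocalizerMorphism G hG).localizedFunctor
      (coacyclic conf).trW.Q (coacyclic conf').trW.Q)).symm.hom ℤ)

instance isTriangulated_coderivedFunctor
    (hG : ∀ S : ShortComplex E, conf S → conf' (S.map G))
    [HasCoproducts.{v} E] [∀ J : Type v, PreservesColimitsOfShape (Discrete J) G] :
    (coderivedFunctor G hG).IsTriangulated := by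
  have := Localization.essSurj_mapArrow (coacyclic conf).trW.Q (coacyclic conf).trW
  have : (coacyclic conf).trW.Q.IsTriangulated :=
    Triangulated.Localization.isTriangulated_functor _ (coacyclic conf).trW
  have : (coacyclic conf').trW.Q.IsTriangulated :=
    Triangulated.Localization.isTriangulated_functor _ (coacyclic conf').trW
  exact Functor.isTriangulated_of_precomp_iso (coderivedFunctorFactors G hG)

end Functoriality

end General

section Modules

variable (A : Type u) [Ring A]

/-- A ring `A` is left coherent if any finitely generated submodule of a finitely presented left
`A`-module is finitely presented. -/
def IsLeftCoherent : Prop :=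
  ∀ (M : Type u) [AddCommGroup M] [Module A M], Module.FinitePresentation A M →
    ∀ N : Submodule A M, N.FG → Module.FinitePresentation A N

/-- A left `A`-module `J` is fp-injective if the functor `Hom_A(-, J)` takes short exact
sequences of finitely presented left `A`-modules to short exact sequences of abelian groups. -/
def IsFPInjective : ObjectProperty (ModuleCat.{u} A) := fun J =>
  ∀ S : ShortComplex (ModuleCat.{u} A), S.ShortExact →
    Module.FinitePresentation A S.X₁ → Module.FinitePresentation A S.X₂ →
    Module.FinitePresentation A S.X₃ →
    (S.op.map (preadditiveYoneda.obj J)).ShortExact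

variable {A}

lemma shortExact_map_preadditiveYoneda_iff (J : ModuleCat.{u} A)
    (S : ShortComplex (ModuleCat.{u} A)) (hS : S.ShortExact) :
    (S.op.map (preadditiveYoneda.obj J)).ShortExact ↔
      ∀ f : S.X₁ ⟶ J, ∃ g : S.X₂ ⟶ J, S.f ≫ g = f := by
  have := hS.epi_g
  constructor
  · intro h f
    have := (AddCommGrpCat.epi_iff_surjective _).1 h.epi_g
    exact this f
  · intro h
    refine @ShortComplex.ShortExact.mk _ _ _ _ ?_ ?_ ?_
    · rw [ShortComplex.ab_exact_iff]
      intro (x : S.X₂ ⟶ J) (hx : S.f ≫ x = 0)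
      exact ⟨hS.exact.desc x hx, hS.exact.g_desc x hx⟩
    · rw [AddCommGrpCat.mono_iff_injective]
      intro (x : S.X₃ ⟶ J) (y : S.X₃ ⟶ J) (hxy : S.g ≫ x = S.g ≫ y)
      exact (cancel_epi S.g).1 hxy
    · rw [AddCommGrpCat.epi_iff_surjective]
      exact h


lemma isFPInjective_iff (J : ModuleCat.{u} A) :
    IsFPInjective A J ↔ ∀ S : ShortComplex (ModuleCat.{u} A), S.ShortExact →
      Module.FinitePresentation A S.X₁ → Module.FinitePresentation A S.X₂ →
      Module.FinitePresentation A S.X₃ →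
      ∀ f : S.X₁ ⟶ J, ∃ g : S.X₂ ⟶ J, S.f ≫ g = f := by
  refine forall₅_congr fun S hS _ _ _ => ?_
  exact shortExact_map_preadditiveYoneda_iff J S hS

instance : (IsFPInjective A).IsClosedUnderIsomorphisms where
  of_iso {J J'} e hJ := by
    rw [isFPInjective_iff] at hJ ⊢
    intro S hS h₁ h₂ h₃ f
    obtain ⟨g, hg⟩ := hJ S hS h₁ h₂ h₃ (f ≫ e.inv)
    exact ⟨g ≫ e.hom, by simp [reassoc_of% hg]⟩

/-- Direct sums of fp-injective modules are fp-injective. -/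
lemma isFPInjective_directSum {ι : Type u} (Z : ι → ModuleCat.{u} A)
    (hZ : ∀ i, IsFPInjective A (Z i)) :
    IsFPInjective A (ModuleCat.of A (DirectSum ι (fun i => Z i))) := by
  classical
  rw [isFPInjective_iff]
  intro S hS h₁ h₂ h₃ f
  have hfin : Module.Finite A S.X₁ := inferInstance
  obtain ⟨t, ht⟩ := hfin.fg_top
  let s : Finset ι := t.biUnion (fun x => DFinsupp.support (f x))
  have hs (x : S.X₁) (i : ι) (hi : i ∉ s) : DirectSum.component A ι (fun i => Z i) i (f x) = 0 := by
    have hx : x ∈ Submodule.span A (t : Set S.X₁) := ht ▸ Submodule.mem_top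
    induction hx using Submodule.span_induction with
    | mem x hx =>
      by_contra h
      exact hi (Finset.mem_biUnion.2 ⟨x, hx, DFinsupp.mem_support_iff.2 h⟩)
    | zero => simp
    | add x y _ _ hx hy => simp [hx, hy]
    | smul a x _ hx => simp [hx]
  choose g hg using fun i => (isFPInjective_iff (Z i)).1 (hZ i) S hS h₁ h₂ h₃
    (f ≫ ModuleCat.ofHom (DirectSum.component A ι (fun i => Z i) i))
  refine ⟨∑ i ∈ s, g i ≫ ModuleCat.ofHom (DirectSum.lof A ι (fun i => Z i) i), ?_⟩
  rw [Preadditive.comp_sum]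
  simp only [reassoc_of% hg]
  refine ModuleCat.hom_ext (LinearMap.ext fun x => ?_)
  have key : f x = ∑ i ∈ s, DirectSum.lof A ι (fun i => Z i) i
      (DirectSum.component A ι (fun i => Z i) i (f x)) := by
    refine DirectSum.ext_component A fun i => ?_
    rw [map_sum]
    by_cases hi : i ∈ s
    · rw [Finset.sum_eq_single_of_mem i hi, DirectSum.component.lof_self]
      intro j _ hj
      exact (DirectSum.component.of A i j _).trans (dif_neg hj)
    · rw [hs x i hi, Finset.sum_eq_zero]
      intro j hj
      exact (DirectSum.component.of A i j _).trans (dif_neg (fun h : j = i => hi (h ▸ hj)))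
  simpa using key.symm

instance (J : Type u) : (IsFPInjective A).IsClosedUnderColimitsOfShape (Discrete J) where
  colimitsOfShape_le := by
    classical
    rintro X ⟨p⟩
    let Z : J → ModuleCat.{u} A := fun j => p.diag.obj ⟨j⟩
    let e : Discrete.functor Z ≅ p.diag := Discrete.natIso (fun _ => Iso.refl _)
    have h := IsColimit.coconePointsIsoOfNatIso (ModuleCat.coproductCoconeIsColimit Z)
      p.isColimit e
    exact (IsFPInjective A).prop_of_iso h
      (isFPInjective_directSum Z (fun j => p.prop_diag_obj ⟨j⟩))

/-- The full subcategory of fp-injective left `A`-modules. -/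
abbrev FPInjectiveModule (A : Type u) [Ring A] := (IsFPInjective A).FullSubcategory

instance : HasCoproducts.{u} (FPInjectiveModule A) := inferInstance

instance (J : Type u) : PreservesColimitsOfShape (Discrete J) (IsFPInjective A).ι := inferInstance

instance : HasFiniteCoproducts (FPInjectiveModule A) := hasFiniteCoproducts_of_hasCoproducts _

instance : HasBinaryBiproducts (FPInjectiveModule A) :=
  HasBinaryBiproducts.of_hasBinaryCoproducts

instance : HasZeroObject (FPInjectiveModule A) := hasZeroObject_of_hasInitial_object

variable (A)

/-- The admissible short exact sequences of the abelian category of left `A`-modules: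
all the short exact sequences. -/
def moduleConflations : ObjectProperty (ShortComplex (ModuleCat.{u} A)) :=
  fun S => S.ShortExact

/-- The exact category structure on the fp-injective left `A`-modules inherited from the abelian
category of left `A`-modules: the admissible short exact sequences are the sequences of
fp-injective modules which are short exact as sequences of `A`-modules. -/
def fpInjectiveConflations : ObjectProperty (ShortComplex (FPInjectiveModule A)) :=
  fun S => (S.map (IsFPInjective A).ι).ShortExact

lemma moduleConflations_map_ι (S : ShortComplex (FPInjectiveModule A))
    (hS : fpInjectiveConflations A S) : moduleConflations A (S.map (IsFPInjective A).ι) := hS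

/-- The triangulated functor `D^co(A-mod_fpi) ⥤ D^co(A-mod)` induced by the inclusion of the exact
category of fp-injective left `A`-modules into the abelian category of left `A`-modules. -/
abbrev fpInjectiveCoderivedFunctor :
    CoderivedCategory (fpInjectiveConflations A) ⥤ CoderivedCategory (moduleConflations A) :=
  coderivedFunctor (IsFPInjective A).ι (moduleConflations_map_ι A)

end Modules

end Coderived

end

/-! The homotopy category of complexes of fp-injective modules is reflective in `Hot (ModuleCat A)`,
and the reflection and the inclusion both respect coacyclicity.

A countable small object argument, gluing on contractible disk complexes built from the inclusions
of finitely generated submodules into finite free modules, embeds any complex `M` in a termwise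
fp-injective complex `N` (`exists_isSpecial`). The cokernel is coacyclic, because disks are
contractible and sequential colimits are cokernels of telescopes. Moreover `M ⟶ N` has the left
lifting property against every morphism that, in each degree, has the right lifting property against
those inclusions.

Over a coherent ring, if `F` is termwise fp-injective, then `F ⟶ 0` and the path fibration of `F`
are such morphisms. So `M ⟶ N` induces bijections on homotopy classes of maps to `F`
(`bijective_precomp_of_llp`). Thus the inclusion has a left adjoint `L`, given by `M ↦ N`, whose
unit has coacyclic cones.

It remains to see that `L` takes coacyclic complexes to complexes coacyclic over the fp-injectives.
By minimality it is enough that the preimage under `L` be a coacyclic class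
(`isCoacyclicClass_inverseImage`). Direct sums cause no trouble, as fp-injectives are closed under
them. A short exact sequence is replaced by one of fp-injectives (`exists_shortExact_fpInjective`),
where coherence ensures that cokernels stay fp-injective. Then `L` and the inclusion descend to
mutually inverse equivalences. -/

noncomputable section

namespace Coderived

/-! ### Fp-injectivity as an extension property from finitely generated submodules of free modules
-/

section FPInjective

variable (A : Type u) [Ring A]

/-- The index type of the inclusions of finitely generated submodules of finite free modules. -/
abbrev FGInclusionIndex : Type u := Σ m : ℕ, { K : Submodule A (Fin m → A) // K.FG }

variable {A}

/-- The inclusion of a finitely generated submodule into a finite free module. -/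
abbrev fgInclusion (i : FGInclusionIndex A) :
    ModuleCat.of.{u} A i.2.1 ⟶ ModuleCat.of A (Fin i.1 → A) :=
  ModuleCat.ofHom i.2.1.subtype

variable (A) in
/-- The inclusions of finitely generated submodules into finite free modules. -/
abbrev fgInclusions : MorphismProperty (ModuleCat.{u} A) :=
  MorphismProperty.ofHoms (fgInclusion (A := A))

/-- Coherence makes `K` finitely presented, so `0 → K → Aᵐ → Aᵐ/K → 0` is among the sequences tested
by the definition. -/
lemma IsFPInjective.exists_extension (hA : IsLeftCoherent A) {J : ModuleCat.{u} A}
    (hJ : IsFPInjective A J) (i : FGInclusionIndex A) (f : ModuleCat.of A i.2.1 ⟶ J) :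
    ∃ g : ModuleCat.of A (Fin i.1 → A) ⟶ J, fgInclusion i ≫ g = f := by
  obtain ⟨m, K, hK⟩ := i
  refine (isFPInjective_iff J).1 hJ (ShortComplex.mk (fgInclusion ⟨m, K, hK⟩)
    (ModuleCat.ofHom K.mkQ) (by ext; simp)) ?_ (hA _ inferInstance K hK) ?_ ?_ f
  · refine @ShortComplex.ShortExact.mk _ _ _ _ ?_ ?_ ?_
    · rw [ShortComplex.moduleCat_exact_iff_range_eq_ker]
      simp
    · rw [ModuleCat.mono_iff_injective]
      exact K.injective_subtype
    · rw [ModuleCat.epi_iff_surjective]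
      exact K.mkQ_surjective
  · exact inferInstanceAs (Module.FinitePresentation A (Fin m → A))
  · exact Module.finitePresentation_of_surjective K.mkQ K.mkQ_surjective (by simpa using hK)

lemma exists_comp_eq_of_ker_le {M N P : Type*} [AddCommGroup M] [AddCommGroup N] [AddCommGroup P]
    [Module A M] [Module A N] [Module A P] (π : M →ₗ[A] N) (hπ : Function.Surjective π)
    (g : M →ₗ[A] P) (h : LinearMap.ker π ≤ LinearMap.ker g) : ∃ h : N →ₗ[A] P, h ∘ₗ π = g := by
  refine ⟨(LinearMap.ker π).liftQ g h ∘ₗ (π.quotKerEquivOfSurjective hπ).symm.toLinearMap,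
    LinearMap.ext fun x => ?_⟩
  have : (π.quotKerEquivOfSurjective hπ).symm (π x) = (LinearMap.ker π).mkQ x := by
    rw [LinearEquiv.symm_apply_eq]
    rfl
  simp [this]

/-- Pull the sequence back along a surjection `π : Aᵐ → X₂`. The preimage `K` of `X₁` is finitely
generated because `X₃` is finitely presented. A map extended from `K` to `Aᵐ` kills `ker π`, hence
descends to `X₂`. -/
lemma isFPInjective_of_exists_extension {J : ModuleCat.{u} A}
    (hJ : ∀ (i : FGInclusionIndex A) (f : ModuleCat.of A i.2.1 ⟶ J),
      ∃ g : ModuleCat.of A (Fin i.1 → A) ⟶ J, fgInclusion i ≫ g = f) :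
    IsFPInjective A J := by
  rw [isFPInjective_iff]
  intro S hS _ _ _ f
  obtain ⟨m, π, hπ⟩ := Module.Finite.exists_fin' A S.X₂
  have hg := hS.moduleCat_surjective_g
  have hf := hS.moduleCat_injective_f
  have hex := hS.exact.moduleCat_range_eq_ker
  let K : Submodule A (Fin m → A) := LinearMap.ker (S.g.hom ∘ₗ π)
  have hK : K.FG := Module.FinitePresentation.fg_ker _ (hg.comp hπ)
  let e := LinearEquiv.ofInjective S.f.hom hf
  let r : K →ₗ[A] S.X₁ := e.symm.toLinearMap ∘ₗ
    (π ∘ₗ K.subtype).codRestrict (LinearMap.range S.f.hom) (fun x => by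
      rw [hex]; exact x.2)
  have hr (x : K) : S.f (r x) = π x := by
    have := LinearEquiv.apply_symm_apply e
      ((π ∘ₗ K.subtype).codRestrict (LinearMap.range S.f.hom) (fun x => by
        rw [hex]; exact x.2) x)
    exact congrArg Subtype.val this
  obtain ⟨g, hg'⟩ := hJ ⟨m, K, hK⟩ (ModuleCat.ofHom (f.hom ∘ₗ r))
  have hg'' (x : K) : g.hom (x : Fin m → A) = f (r x) :=
    congrArg (fun φ => φ.hom x) hg'
  have hker : LinearMap.ker π ≤ LinearMap.ker g.hom := fun x hx => by
    have hxK : x ∈ K := by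
      simp only [K, LinearMap.mem_ker, LinearMap.comp_apply] at hx ⊢
      rw [hx, map_zero]
    have h0 : r ⟨x, hxK⟩ = 0 := hf (by
      refine (hr ⟨x, hxK⟩).trans ?_
      simpa using hx)
    have := hg'' ⟨x, hxK⟩
    rw [h0] at this
    simpa using this
  obtain ⟨h, hh⟩ : ∃ h : S.X₂ →ₗ[A] J, h ∘ₗ π = g.hom :=
    exists_comp_eq_of_ker_le π hπ g.hom hker
  refine ⟨ModuleCat.ofHom h, ModuleCat.hom_ext (LinearMap.ext fun y => ?_)⟩
  obtain ⟨x, hx⟩ := hπ (S.f y)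
  have hxK : x ∈ K := by
    simp only [K, LinearMap.mem_ker, LinearMap.comp_apply, hx]
    exact congrArg (fun φ => φ.hom y) S.zero
  have hy : r ⟨x, hxK⟩ = y := hf ((hr ⟨x, hxK⟩).trans hx)
  have h1 := hg'' ⟨x, hxK⟩
  rw [hy, ← hh] at h1
  simpa [hx] using h1

/-- Over a coherent ring, the cokernel of a monomorphism between fp-injective modules is
fp-injective. -/
lemma IsFPInjective.of_shortExact (hA : IsLeftCoherent A) {S : ShortComplex (ModuleCat.{u} A)}
    (hS : S.ShortExact) (h₁ : IsFPInjective A S.X₁) (h₂ : IsFPInjective A S.X₂) :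
    IsFPInjective A S.X₃ := by
  refine isFPInjective_of_exists_extension fun ⟨m, K, hK⟩ f => ?_
  have hg := hS.moduleCat_surjective_g
  have : Module.FinitePresentation A K := hA _ inferInstance K hK
  -- Lift `f` through `S.g`, which amounts to `Ext¹(K, X₁) = 0`. A lift `φ` on the free cover of `K`
  -- maps the relations `ker π` into `X₁`. Extending that map to `σ` on the whole cover and
  -- subtracting it makes `φ` descend to `K`.
  obtain ⟨r, π, hπ⟩ := Module.Finite.exists_fin' A K
  have hR : (LinearMap.ker π).FG := Module.FinitePresentation.fg_ker π hπ
  obtain ⟨φ, hφ⟩ := Module.projective_lifting_property S.g.hom (f.hom ∘ₗ π) hg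
  have := hS.mono_f
  let ρ : ModuleCat.of A (LinearMap.ker π) ⟶ S.X₁ := hS.exact.lift
    (ModuleCat.ofHom (φ ∘ₗ (LinearMap.ker π).subtype)) (by
      ext x
      have h := LinearMap.congr_fun hφ (x : Fin r → A)
      have hx : π x = 0 := x.2
      simpa [hx] using h)
  obtain ⟨σ, hσ⟩ := h₁.exists_extension hA ⟨r, LinearMap.ker π, hR⟩ ρ
  let φ' : (Fin r → A) →ₗ[A] S.X₂ := φ - S.f.hom ∘ₗ σ.hom
  have hker : LinearMap.ker π ≤ LinearMap.ker φ' := fun x hx => by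
    have h1 := congrArg (fun q => q.hom ⟨x, hx⟩) (congrArg (· ≫ S.f) hσ)
    simp only [ρ, hS.exact.lift_f] at h1
    simp only [φ', LinearMap.mem_ker, LinearMap.sub_apply, LinearMap.comp_apply]
    exact sub_eq_zero.2 h1.symm
  obtain ⟨h, hh⟩ : ∃ h : K →ₗ[A] S.X₂, h ∘ₗ π = φ' :=
    exists_comp_eq_of_ker_le π hπ φ' hker
  obtain ⟨q, hq⟩ := h₂.exists_extension hA ⟨m, K, hK⟩ (ModuleCat.ofHom h)
  refine ⟨q ≫ S.g, ?_⟩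
  rw [reassoc_of% hq]
  refine ModuleCat.hom_ext (LinearMap.ext fun y => ?_)
  obtain ⟨x, rfl⟩ := hπ y
  have h1 : h (π x) = φ x - S.f (σ x) := LinearMap.congr_fun hh x
  have h2 : S.g (S.f (σ x)) = 0 := congrArg (fun q => q.hom (σ.hom x)) S.zero
  have h3 : S.g (φ x) = f (π x) := LinearMap.congr_fun hφ x
  change S.g (h (π x)) = f (π x)
  rw [h1, map_sub, h2, h3, sub_zero]

end FPInjective

/-! ### Closure properties of coacyclic complexes of modules -/

section Coacyclic

variable {A : Type u} [Ring A]

variable (A) in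
/-- The complexes of left `A`-modules. -/
abbrev Kom := CochainComplex (ModuleCat.{u} A) ℤ

variable (A) in
/-- The canonical functor from the complexes to the homotopy category. -/
abbrev quot : Kom A ⥤ Hot (ModuleCat.{u} A) :=
  HomotopyCategory.quotient (ModuleCat.{u} A) (ComplexShape.up ℤ)

/-- The property that a complex of modules is coacyclic. -/
abbrev IsCoacyclic (X : Kom A) : Prop :=
  coacyclic (moduleConflations A) ((quot A).obj X)

lemma IsCoacyclic.of_iso {X Y : Kom A} (hX : IsCoacyclic X) (e : X ≅ Y) : IsCoacyclic Y :=
  (coacyclic (moduleConflations A)).prop_of_iso ((quot A).mapIso e) hX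

lemma IsCoacyclic.of_homotopy {X : Kom A} (h : Homotopy (𝟙 X) 0) : IsCoacyclic X :=
  (coacyclic (moduleConflations A)).prop_of_isZero
    ((HomotopyCategory.isZero_quotient_obj_iff X).2 ⟨h⟩)

lemma IsCoacyclic.sigma {ι : Type u} {X : ι → Kom A} (hX : ∀ i, IsCoacyclic (X i)) :
    IsCoacyclic (∐ X) :=
  (isCoacyclicClass_coacyclic (moduleConflations A)).directSum_mem X
    (Cofan.mk _ (Sigma.ι X)) (coproductIsCoproduct X) hX

lemma isCoacyclic_totalization {S : ShortComplex (Kom A)} (hS : S.ShortExact) :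
    IsCoacyclic (totalization S) :=
  (isCoacyclicClass_coacyclic (moduleConflations A)).totalization_mem S
    (fun n => hS.map_of_exact (HomologicalComplex.eval (ModuleCat.{u} A) (ComplexShape.up ℤ) n))

/-- The total complex is the cone of the comparison map from the cone of `S.f` to `S.X₃`, and it is
coacyclic. -/
lemma isCoacyclic_mappingCone_iff {S : ShortComplex (Kom A)} (hS : S.ShortExact) :
    IsCoacyclic (CochainComplex.mappingCone S.f) ↔ IsCoacyclic S.X₃ := by
  have h := HomotopyCategory.mappingCone_triangleh_distinguished (coneDesc S)
  have h' := isCoacyclic_totalization hS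
  exact ⟨fun h₁ => (coacyclic (moduleConflations A)).ext_of_isTriangulatedClosed₂ _ h h₁ h',
    fun h₂ => (coacyclic (moduleConflations A)).ext_of_isTriangulatedClosed₁ _ h h₂ h'⟩

lemma trW_iff_of_shortExact {S : ShortComplex (Kom A)} (hS : S.ShortExact) :
    (coacyclic (moduleConflations A)).trW ((quot A).map S.f) ↔ IsCoacyclic S.X₃ :=
  ((coacyclic (moduleConflations A)).trW_iff_of_distinguished _
    (HomotopyCategory.mappingCone_triangleh_distinguished S.f)).trans
      (isCoacyclic_mappingCone_iff hS)

lemma IsCoacyclic.of_shortExact {S : ShortComplex (Kom A)} (hS : S.ShortExact)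
    (h₁ : IsCoacyclic S.X₁) (h₂ : IsCoacyclic S.X₂) : IsCoacyclic S.X₃ :=
  (isCoacyclic_mappingCone_iff hS).1
    ((coacyclic (moduleConflations A)).ext_of_isTriangulatedClosed₃ _
      (HomotopyCategory.mappingCone_triangleh_distinguished S.f) h₁ h₂)

lemma shortExact_cokernel {C : Type*} [Category* C] [Abelian C] {X Y : C} (f : X ⟶ Y) [Mono f] :
    (ShortComplex.mk f (cokernel.π f) (cokernel.condition f)).ShortExact where
  exact := ShortComplex.exact_of_g_is_cokernel _ (cokernelIsCokernel f)

/-- The projections of a direct sum of modules are jointly injective. -/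
lemma eq_zero_of_forall_proj {ι : Type u} {Z : ι → ModuleCat.{u} A} (c : Cofan Z)
    (hc : IsColimit c) (π : ∀ i, c.pt ⟶ Z i) (hπ : ∀ i, c.inj i ≫ π i = 𝟙 _)
    (hπ' : ∀ i j, i ≠ j → c.inj i ≫ π j = 0) (x : c.pt) (hx : ∀ i, π i x = 0) : x = 0 := by
  classical
  let e : c.pt ≅ ModuleCat.of A (DirectSum ι (fun i => Z i)) :=
    hc.coconePointUniqueUpToIso (ModuleCat.coproductCoconeIsColimit Z)
  have he (i : ι) : c.inj i ≫ e.hom = ModuleCat.ofHom (DirectSum.lof A ι (fun i => Z i) i) :=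
    hc.comp_coconePointUniqueUpToIso_hom (ModuleCat.coproductCoconeIsColimit Z) ⟨i⟩
  have hp (j : ι) : e.hom ≫ ModuleCat.ofHom (DirectSum.component A ι (fun i => Z i) j) = π j := by
    refine Cofan.IsColimit.hom_ext hc _ _ fun i => ?_
    rw [reassoc_of% (he i)]
    by_cases h : i = j
    · subst h
      rw [hπ]
      ext x
      simp
    · rw [hπ' i j h]
      ext x
      exact (DirectSum.component.of A j i _).trans (dif_neg h)
  have : e.hom x = 0 := DirectSum.ext_component A fun j => by
    have := congrArg (fun φ => φ.hom x) (hp j)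
    rw [map_zero]
    exact this.trans (hx j)
  have := congrArg e.inv this
  simpa using this

/-! ### The telescope of a sequence of complexes -/

section Telescope

variable (F : ℕ ⥤ Kom A)

/-- The endomorphism `1 - s` of the direct sum of a sequence, where `s` is induced by the
transition maps. -/
def telescopeMap :
    (∐ fun n : ULift.{u} ℕ => F.obj n.down) ⟶ ∐ fun n : ULift.{u} ℕ => F.obj n.down :=
  Sigma.desc fun n => Sigma.ι (fun n : ULift.{u} ℕ => F.obj n.down) n -
    F.map (homOfLE (Nat.le_add_right n.down 1)) ≫
      Sigma.ι (fun n : ULift.{u} ℕ => F.obj n.down) ⟨n.down + 1⟩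

lemma ι_telescopeMap (n : ULift.{u} ℕ) :
    Sigma.ι (fun n : ULift.{u} ℕ => F.obj n.down) n ≫ telescopeMap F =
      Sigma.ι (fun n : ULift.{u} ℕ => F.obj n.down) n -
        F.map (homOfLE (Nat.le_add_right n.down 1)) ≫
        Sigma.ι (fun n : ULift.{u} ℕ => F.obj n.down) ⟨n.down + 1⟩ := by
  simp [telescopeMap]

/-- The projections of the direct sum of a sequence. -/
def telescopeProj (k : ℕ) : (∐ fun n : ULift.{u} ℕ => F.obj n.down) ⟶ F.obj k :=
  Sigma.desc fun n => if h : n.down = k then eqToHom (by rw [h]) else 0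

lemma ι_telescopeProj_self (k : ℕ) :
    Sigma.ι (fun n : ULift.{u} ℕ => F.obj n.down) ⟨k⟩ ≫ telescopeProj F k = 𝟙 _ := by
  simp [telescopeProj]

lemma ι_telescopeProj_of_ne (n : ULift.{u} ℕ) (k : ℕ) (h : n.down ≠ k) :
    Sigma.ι (fun n : ULift.{u} ℕ => F.obj n.down) n ≫ telescopeProj F k = 0 := by
  simp [telescopeProj, h]

lemma telescopeMap_proj_zero : telescopeMap F ≫ telescopeProj F 0 = telescopeProj F 0 := by
  refine Sigma.hom_ext _ _ fun n => ?_
  rw [reassoc_of% (ι_telescopeMap F), Preadditive.sub_comp, Category.assoc,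
    ι_telescopeProj_of_ne F ⟨n.down + 1⟩ 0 (by simp), comp_zero, sub_zero]

lemma telescopeMap_proj_succ (k : ℕ) : telescopeMap F ≫ telescopeProj F (k + 1) =
    telescopeProj F (k + 1) -
      telescopeProj F k ≫ F.map (homOfLE (Nat.le_add_right k 1)) := by
  refine Sigma.hom_ext _ _ fun ⟨n⟩ => ?_
  rw [reassoc_of% (ι_telescopeMap F), Preadditive.sub_comp, Preadditive.comp_sub, Category.assoc]
  congr 1
  by_cases h : n = k
  · subst h
    rw [ι_telescopeProj_self, reassoc_of% (ι_telescopeProj_self F), Category.comp_id]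
  · rw [ι_telescopeProj_of_ne F ⟨n + 1⟩ _ (by simpa using h),
      reassoc_of% (ι_telescopeProj_of_ne F ⟨n⟩ k h), comp_zero, zero_comp]

/-- If `x` is killed by `1 - s`, then `x₀ = 0` and each `xₖ₊₁` is the image of `xₖ`, so all
components vanish by induction. -/
instance : Mono (telescopeMap F) := by
  have (n : ℤ) : Mono ((telescopeMap F).f n) := by
    rw [ModuleCat.mono_iff_injective, injective_iff_map_eq_zero]
    intro x hx
    have key (k : ℕ) : ((telescopeProj F k).f n) x = 0 := by
      induction k with
      | zero =>
        have := congrArg (fun φ => (φ.f n).hom x) (telescopeMap_proj_zero F)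
        simpa [hx] using this.symm
      | succ k ih =>
        have := congrArg (fun φ => (φ.f n).hom x) (telescopeMap_proj_succ F k)
        simpa [hx, ih] using this.symm
    refine eq_zero_of_forall_proj _ (isColimitCofanMkObjOfIsColimit
      (HomologicalComplex.eval (ModuleCat.{u} A) (ComplexShape.up ℤ) n)
      (fun n : ULift.{u} ℕ => F.obj n.down) _ (coproductIsCoproduct _))
      (fun k => (telescopeProj F k.down).f n) (fun k => ?_) (fun j k h => ?_) x
      (fun k => key k.down)
    · exact congrArg (fun φ => φ.f n) (ι_telescopeProj_self F k.down)
    · exact congrArg (fun φ => φ.f n)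
        (ι_telescopeProj_of_ne F j k.down (fun h' => h (ULift.ext _ _ h')))
  exact HomologicalComplex.mono_of_mono_f _ this

variable {F} (c : Cocone F)

/-- The morphism from the direct sum of a sequence to the point of a cocone. -/
def telescopeDesc : (∐ fun n : ULift.{u} ℕ => F.obj n.down) ⟶ c.pt :=
  Sigma.desc fun n : ULift.{u} ℕ => c.ι.app n.down

lemma ι_telescopeDesc (n : ULift.{u} ℕ) :
    Sigma.ι (fun n : ULift.{u} ℕ => F.obj n.down) n ≫ telescopeDesc c = c.ι.app n.down := by
  simp [telescopeDesc]

lemma telescopeMap_desc : telescopeMap F ≫ telescopeDesc c = 0 :=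
  Sigma.hom_ext _ _ fun n => by
    rw [reassoc_of% (ι_telescopeMap F), Preadditive.sub_comp, Category.assoc, ι_telescopeDesc,
      ι_telescopeDesc, c.w, sub_self, comp_zero]

-- A morphism out of the direct sum that kills `1 - s` is the same thing as a cocone, so the
-- cokernel of `1 - s` is the colimit.
variable {c} in
lemma shortExact_telescope (hc : IsColimit c) :
    (ShortComplex.mk _ _ (telescopeMap_desc c)).ShortExact := by
  let t {Z : Kom A} (k : (∐ fun n : ULift.{u} ℕ => F.obj n.down) ⟶ Z)
      (hk : telescopeMap F ≫ k = 0) : Cocone F :=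
    { pt := Z
      ι := NatTrans.ofSequence (fun n => Sigma.ι (fun n : ULift.{u} ℕ => F.obj n.down) ⟨n⟩ ≫ k)
        (fun n => by
          have := Sigma.ι (fun n : ULift.{u} ℕ => F.obj n.down) ⟨n⟩ ≫= hk
          rw [reassoc_of% (ι_telescopeMap F), Preadditive.sub_comp, comp_zero,
            sub_eq_zero, Category.assoc] at this
          simpa using this.symm) }
  have hg : IsColimit (CokernelCofork.ofπ (telescopeDesc c) (telescopeMap_desc c)) :=
    CokernelCofork.IsColimit.ofπ _ _ (fun k hk => hc.desc (t k hk))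
      (fun k hk => Sigma.hom_ext _ _ fun n => by
        rw [reassoc_of% (ι_telescopeDesc c)]
        exact hc.fac (t k hk) n.down)
      (fun k hk m hm => hc.hom_ext fun n => by
        rw [hc.fac (t k hk) n, ← reassoc_of% (ι_telescopeDesc c ⟨n⟩), hm]
        rfl)
  have : Epi (telescopeDesc c) := epi_of_isColimit_cofork hg
  exact { exact := ShortComplex.exact_of_g_is_cokernel _ hg }

lemma IsCoacyclic.of_isColimit {c : Cocone F} (hc : IsColimit c)
    (hF : ∀ n, IsCoacyclic (F.obj n)) : IsCoacyclic c.pt :=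
  .of_shortExact (shortExact_telescope hc) (.sigma fun n => hF n.down)
    (.sigma fun n => hF n.down)

end Telescope

end Coacyclic

/-! ### Disk complexes -/

section Disk

variable {A : Type u} [Ring A]

/-- The contractible complex consisting of a module placed in the degrees `n` and `n + 1`. -/
def disk (n : ℤ) (X : ModuleCat.{u} A) : Kom A :=
  HomologicalComplex.double (𝟙 X) (c := ComplexShape.up ℤ) (i₀ := n) (i₁ := n + 1) rfl

/-- The component of a disk complex in its lowest degree. -/
def diskIso₀ (n : ℤ) (X : ModuleCat.{u} A) : (disk n X).X n ≅ X :=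
  HomologicalComplex.doubleXIso₀ _ _

/-- The component of a disk complex in its highest degree. -/
def diskIso₁ (n : ℤ) (X : ModuleCat.{u} A) : (disk n X).X (n + 1) ≅ X :=
  HomologicalComplex.doubleXIso₁ _ _ (by simp)

lemma disk_d (n : ℤ) (X : ModuleCat.{u} A) :
    (disk n X).d n (n + 1) = (diskIso₀ n X).hom ≫ (diskIso₁ n X).inv :=
  (HomologicalComplex.double_d (𝟙 X) (c := ComplexShape.up ℤ) (i₀ := n) (i₁ := n + 1) rfl
    (by simp)).trans (by rw [Category.id_comp]; rfl)

/-- The nonzero differential is invertible, so the component in degree `n` determines the one in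
degree `n + 1`. With `diskDesc`, this says that `disk n` is left adjoint to evaluation in degree
`n`. -/
lemma disk_hom_ext {n : ℤ} {X : ModuleCat.{u} A} {M : Kom A} {f g : disk n X ⟶ M}
    (h : f.f n = g.f n) : f = g := by
  refine HomologicalComplex.from_double_hom_ext h ?_
  have hf := f.comm n (n + 1)
  rw [h, g.comm n (n + 1), disk_d, Category.assoc, Category.assoc] at hf
  exact ((cancel_epi (diskIso₁ n X).inv).1 ((cancel_epi (diskIso₀ n X).hom).1 hf)).symm

/-- The morphism from a disk complex induced by a morphism of modules. -/
def diskDesc {n : ℤ} {X : ModuleCat.{u} A} {M : Kom A} (f : X ⟶ M.X n) : disk n X ⟶ M :=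
  HomologicalComplex.mkHomFromDouble _ (by simp) f (f ≫ M.d n (n + 1)) (by simp) (by simp)

@[simp]
lemma diskDesc_f {n : ℤ} {X : ModuleCat.{u} A} {M : Kom A} (f : X ⟶ M.X n) :
    (diskDesc f).f n = (diskIso₀ n X).hom ≫ f :=
  HomologicalComplex.mkHomFromDouble_f₀ _ _ _ _ _ _

lemma diskDesc_f_succ {n : ℤ} {X : ModuleCat.{u} A} {M : Kom A} (f : X ⟶ M.X n) :
    (diskDesc f).f (n + 1) = (diskIso₁ n X).hom ≫ f ≫ M.d n (n + 1) :=
  HomologicalComplex.mkHomFromDouble_f₁ _ _ _ _ _ _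

/-- The morphism of disk complexes induced by a morphism of modules. -/
def diskMap (n : ℤ) {X Y : ModuleCat.{u} A} (f : X ⟶ Y) : disk n X ⟶ disk n Y :=
  diskDesc (f ≫ (diskIso₀ n Y).inv)

@[simp]
lemma diskMap_f (n : ℤ) {X Y : ModuleCat.{u} A} (f : X ⟶ Y) :
    (diskMap n f).f n = (diskIso₀ n X).hom ≫ f ≫ (diskIso₀ n Y).inv := by
  simp [diskMap]

lemma diskMap_f_succ (n : ℤ) {X Y : ModuleCat.{u} A} (f : X ⟶ Y) :
    (diskMap n f).f (n + 1) = (diskIso₁ n X).hom ≫ f ≫ (diskIso₁ n Y).inv := by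
  simp [diskMap, diskDesc_f_succ, disk_d]

instance mono_diskMap (n : ℤ) {X Y : ModuleCat.{u} A} (f : X ⟶ Y) [Mono f] :
    Mono (diskMap n f) := by
  have (k : ℤ) : Mono ((diskMap n f).f k) := by
    by_cases h₀ : k = n
    · subst h₀
      rw [diskMap_f]
      infer_instance
    by_cases h₁ : k = n + 1
    · subst h₁
      rw [diskMap_f_succ]
      infer_instance
    exact ⟨fun _ _ _ =>
      (HomologicalComplex.isZero_double_X (c := ComplexShape.up ℤ) _ _ k h₀ h₁).eq_of_tgt _ _⟩
  exact HomologicalComplex.mono_of_mono_f _ this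

/-- The inverse of the differential is a contracting homotopy. -/
lemma isCoacyclic_disk (n : ℤ) (X : ModuleCat.{u} A) : IsCoacyclic (disk n X) := by
  let h (i j : ℤ) (hij : (ComplexShape.up ℤ).Rel j i) : (disk n X).X i ⟶ (disk n X).X j :=
    if hj : j = n then eqToHom (by rw [← hij, hj]) ≫ (diskIso₁ n X).hom ≫
      (diskIso₀ n X).inv ≫ eqToHom (by rw [hj])
    else 0
  have : Homotopy.nullHomotopicMap' h = 𝟙 (disk n X) := by
    refine disk_hom_ext ?_
    rw [Homotopy.nullHomotopicMap'_f (k₂ := n - 1) (k₀ := n + 1) (by simp) rfl]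
    simp [h, disk_d]
  exact .of_homotopy ((Homotopy.ofEq this.symm).trans (Homotopy.nullHomotopy' h))

end Disk

/-! ### Special monomorphisms -/

section Special

variable {A : Type u} [Ring A]

variable (A) in
/-- The morphisms of complexes which have, in every degree, the right lifting property with
respect to the inclusions of finitely generated submodules into finite free modules. -/
def termwiseRlp : MorphismProperty (Kom A) := fun _ _ p => ∀ n, (fgInclusions A).rlp (p.f n)

/-- By the universal property of disks, the lifting problem is equivalent to one between modules in
degree `n`. -/
lemma llp_diskMap (n : ℤ) (i : FGInclusionIndex A) :
    (termwiseRlp A).llp (diskMap n (fgInclusion i)) := fun X Y p hp => ⟨fun {a b} sq => by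
  have := hp n _ ⟨i⟩
  have sq' : CommSq ((diskIso₀ n _).inv ≫ a.f n) (fgInclusion i) (p.f n)
      ((diskIso₀ n _).inv ≫ b.f n) := ⟨by
    have := congrArg (fun φ => (diskIso₀ n _).inv ≫ φ.f n) sq.w
    simpa using this⟩
  exact ⟨⟨{
    l := diskDesc sq'.lift
    fac_left := disk_hom_ext (by simp)
    fac_right := disk_hom_ext (by simp) }⟩⟩⟩

/-- The monomorphisms of complexes with a coacyclic cokernel, which have the left lifting property
with respect to the morphisms in `termwiseRlp A`. -/
structure IsSpecial {X Y : Kom A} (f : X ⟶ Y) : Prop where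
  mono : Mono f
  llp : (termwiseRlp A).llp f
  isCoacyclic_cokernel : IsCoacyclic (cokernel f)

/-- A pushout does not change the cokernel, and in an abelian category it preserves monomorphisms.
-/
lemma IsSpecial.of_isPushout {X X' Y Y' : Kom A} {f : X ⟶ X'} {g : X ⟶ Y} {g' : X' ⟶ Y'}
    {f' : Y ⟶ Y'} (sq : IsPushout g f f' g') (hf : IsSpecial f) : IsSpecial f' where
  mono := by
    have := hf.mono
    exact (MorphismProperty.monomorphisms (Kom A)).of_isPushout sq hf.mono
  llp := (termwiseRlp A).llp.of_isPushout sq hf.llp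
  isCoacyclic_cokernel := by
    have := isIso_cokernel_map_of_isPushout sq.flip
    exact hf.isCoacyclic_cokernel.of_iso (asIso (cokernel.map _ _ _ _ sq.flip.w))

end Special

/-! ### One step of the small object argument -/

section Step

variable {A : Type u} [Ring A]

variable (M : Kom A)

/-- The index type of the extension problems for the components of a complex. -/
abbrev StepIndex : Type u :=
  Σ (n : ℤ) (i : FGInclusionIndex A), (ModuleCat.of A i.2.1 ⟶ M.X n)

/-- The direct sum of the sources of the extension problems. -/
abbrev stepSource : Kom A := ∐ fun s : StepIndex M => disk s.1 (ModuleCat.of A s.2.1.2.1)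

/-- The direct sum of the targets of the extension problems. -/
abbrev stepTarget : Kom A := ∐ fun s : StepIndex M => disk s.1 (ModuleCat.of A (Fin s.2.1.1 → A))

/-- The direct sum of the inclusions of the extension problems. -/
abbrev stepMap : stepSource M ⟶ stepTarget M :=
  Limits.Sigma.map fun s : StepIndex M => diskMap s.1 (fgInclusion s.2.1)

/-- The morphism from the sources of the extension problems to the given complex. -/
abbrev stepDesc : stepSource M ⟶ M := Sigma.desc fun s : StepIndex M => diskDesc s.2.2

/-- The complex obtained by freely solving all the extension problems. -/
abbrev step : Kom A := pushout (stepDesc M) (stepMap M)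

/-- The canonical morphism to the complex where the extension problems are solved. -/
abbrev toStep : M ⟶ step M := pushout.inl _ _

instance (i : FGInclusionIndex A) : Mono (fgInclusion i) := by
  rw [ModuleCat.mono_iff_injective]
  exact i.2.1.injective_subtype

lemma isSpecial_stepMap : IsSpecial (stepMap M) := by
  have hm : Mono (stepMap M) := inferInstance
  exact {
    mono := hm
    llp := MorphismProperty.colimMap _ (fun s => llp_diskMap s.as.1 s.as.2.1)
    isCoacyclic_cokernel := .of_shortExact (shortExact_cokernel _)
      (.sigma fun s => isCoacyclic_disk _ _) (.sigma fun s => isCoacyclic_disk _ _) }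

lemma isSpecial_toStep : IsSpecial (toStep M) :=
  .of_isPushout (IsPushout.of_hasPushout _ _) (isSpecial_stepMap M)

/-- The extension is the degree `n` component of the disk glued on for the problem `(n, i, f)`; the
identity is the pushout square restricted to that summand. -/
lemma exists_extension_toStep {n : ℤ} (i : FGInclusionIndex A) (f : ModuleCat.of A i.2.1 ⟶ M.X n) :
    ∃ g : ModuleCat.of A (Fin i.1 → A) ⟶ (step M).X n, fgInclusion i ≫ g = f ≫ (toStep M).f n := by
  let s : StepIndex M := ⟨n, i, f⟩
  refine ⟨(diskIso₀ n _).inv ≫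
    (Sigma.ι (fun s : StepIndex M => disk s.1 (ModuleCat.of A (Fin s.2.1.1 → A))) s ≫
      pushout.inr (stepDesc M) (stepMap M)).f n, ?_⟩
  have h := Sigma.ι (fun s : StepIndex M => disk s.1 (ModuleCat.of A s.2.1.2.1)) s ≫=
    pushout.condition (f := stepDesc M) (g := stepMap M)
  rw [Sigma.ι_desc_assoc, Sigma.ι_map_assoc] at h
  have h' : (diskDesc f).f n ≫ (toStep M).f n =
      (diskMap n (fgInclusion i)).f n ≫
        (Sigma.ι (fun s : StepIndex M => disk s.1 (ModuleCat.of A (Fin s.2.1.1 → A))) s ≫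
          pushout.inr (stepDesc M) (stepMap M)).f n := congrArg (fun φ => φ.f n) h
  rw [diskDesc_f, diskMap_f, Category.assoc, Category.assoc, Category.assoc] at h'
  exact ((cancel_epi _).1 h').symm

end Step

/-! ### Cokernels along a sequence and their colimit -/

section CokernelSequence

variable {C : Type*} [Category* C] [Abelian C] {F : ℕ ⥤ C}

variable (F) in
/-- The sequence of the cokernels of the morphisms from the first object of a sequence. -/
def cokernelSequence : ℕ ⥤ C where
  obj n := cokernel (F.map (homOfLE n.zero_le))
  map φ := cokernel.map _ _ (𝟙 _) (F.map φ) (by rw [Category.id_comp, ← F.map_comp]; rfl)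
  map_id n := by
    refine coequalizer.hom_ext ?_
    simp
  map_comp φ ψ := by
    refine coequalizer.hom_ext ?_
    simp

/-- The canonical morphism to the sequence of cokernels. -/
def toCokernelSequence (n : ℕ) : F.obj n ⟶ (cokernelSequence F).obj n :=
  cokernel.π (F.map (homOfLE n.zero_le))

instance (n : ℕ) : Epi (toCokernelSequence (F := F) n) :=
  inferInstanceAs (Epi (cokernel.π _))

lemma toCokernelSequence_naturality {n m : ℕ} (φ : n ⟶ m) :
    toCokernelSequence n ≫ (cokernelSequence F).map φ = F.map φ ≫ toCokernelSequence m :=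
  cokernel.π_desc _ _ _

lemma toCokernelSequence_zero : toCokernelSequence (F := F) 0 = 0 := by
  have h : F.map (homOfLE (Nat.zero_le 0)) ≫ toCokernelSequence (F := F) 0 = 0 :=
    cokernel.condition _
  rwa [show F.map (homOfLE (Nat.zero_le 0)) = 𝟙 _ from F.map_id 0, Category.id_comp] at h

/-- The cokernels of the morphisms to the objects of a cocone form a cocone. -/
def cokernelCocone (c : Cocone F) : Cocone (cokernelSequence F) where
  pt := cokernel (c.ι.app 0)
  ι :=
    { app n := cokernel.map _ _ (𝟙 _) (c.ι.app n) (by simp)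
      naturality n m φ := by
        refine coequalizer.hom_ext ?_
        simp [cokernelSequence] }

lemma toCokernelSequence_cokernelCocone_ι (c : Cocone F) (n : ℕ) :
    toCokernelSequence n ≫ (cokernelCocone c).ι.app n = c.ι.app n ≫ cokernel.π (c.ι.app 0) :=
  cokernel.π_desc _ _ _

/-- The cokernels commute with the colimits of sequences. -/
def isColimitCokernelCocone {c : Cocone F} (hc : IsColimit c) : IsColimit (cokernelCocone c) :=
  -- A cocone on the cokernels pulls back to a cocone on `F` whose leg at `0` is zero, so the map it
  -- induces on the colimit factors through the cokernel.
  let t (s : Cocone (cokernelSequence F)) : Cocone F :=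
    { pt := s.pt
      ι :=
        { app n := toCokernelSequence n ≫ s.ι.app n
          naturality n m φ := by
            simp [← reassoc_of% (toCokernelSequence_naturality φ)] } }
  have ht (s : Cocone (cokernelSequence F)) : c.ι.app 0 ≫ hc.desc (t s) = 0 := by
    rw [hc.fac]
    simp [t, toCokernelSequence_zero]
  { desc s := cokernel.desc _ (hc.desc (t s)) (ht s)
    fac s n := by
      rw [← cancel_epi (toCokernelSequence n)]
      refine ((reassoc_of% (toCokernelSequence_cokernelCocone_ι c n))
        (cokernel.desc _ (hc.desc (t s)) (ht s))).trans ?_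
      exact (Category.assoc _ _ _).trans
        ((congrArg _ (cokernel.π_desc _ _ _)).trans (hc.fac (t s) n))
    uniq s m hm := by
      refine coequalizer.hom_ext (hc.hom_ext fun n => ?_)
      have := toCokernelSequence n ≫= hm n
      rw [reassoc_of% (toCokernelSequence_cokernelCocone_ι c)] at this
      refine (Category.assoc _ _ _).symm.trans (this.trans ((hc.fac (t s) n).symm.trans ?_))
      exact congrArg _ (cokernel.π_desc _ _ _).symm }

end CokernelSequence

/-! ### Special monomorphisms and colimits of sequences -/

section Sequence

variable {A : Type u} [Ring A] {F : ℕ ⥤ Kom A}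

/-- A colimit of a sequence is a transfinite composition. -/
def transfiniteCompositionOfIsColimit {c : Cocone F} (hc : IsColimit c)
    (W : MorphismProperty (Kom A)) (hW : ∀ n, W (F.map (homOfLE (Nat.le_add_right n 1)))) :
    W.TransfiniteCompositionOfShape ℕ (c.ι.app 0) where
  F := F
  isoBot := Iso.refl _
  incl := c.ι
  isColimit := hc
  fac := Category.id_comp _
  map_mem j _ := hW j

lemma IsSpecial.trW {X Y : Kom A} {f : X ⟶ Y} (hf : IsSpecial f) :
    (coacyclic (moduleConflations A)).trW ((quot A).map f) := by
  have := hf.mono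
  exact (trW_iff_of_shortExact (shortExact_cokernel f)).2 hf.isCoacyclic_cokernel

lemma IsSpecial.comp {X Y Z : Kom A} {f : X ⟶ Y} {g : Y ⟶ Z} (hf : IsSpecial f)
    (hg : IsSpecial g) : IsSpecial (f ≫ g) := by
  have := hf.mono
  have := hg.mono
  exact {
    mono := inferInstance
    llp := (termwiseRlp A).llp.comp_mem _ _ hf.llp hg.llp
    isCoacyclic_cokernel := (trW_iff_of_shortExact (shortExact_cokernel (f ≫ g))).1 (by
      rw [Functor.map_comp]
      exact (coacyclic (moduleConflations A)).trW.comp_mem _ _ hf.trW hg.trW) }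

lemma IsSpecial.id (X : Kom A) : IsSpecial (𝟙 X) where
  mono := inferInstance
  llp := (termwiseRlp A).llp.id_mem X
  isCoacyclic_cokernel := (coacyclic (moduleConflations A)).prop_of_isZero
    ((quot A).map_isZero (isZero_cokernel_of_epi (𝟙 X)))

lemma IsSpecial.of_isColimit {c : Cocone F} (hc : IsColimit c)
    (hF : ∀ n, IsSpecial (F.map (homOfLE (Nat.le_add_right n 1)))) : IsSpecial (c.ι.app 0) where
  mono := by
    have := MorphismProperty.IsStableUnderTransfiniteComposition.shrink₀.{u}
      (MorphismProperty.monomorphisms (Kom A))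
    exact (MorphismProperty.monomorphisms (Kom A)).transfiniteCompositionsOfShape_le ℕ _
      ⟨transfiniteCompositionOfIsColimit hc _ fun n => (hF n).mono⟩
  llp := (termwiseRlp A).llp.transfiniteCompositionsOfShape_le ℕ _
    ⟨transfiniteCompositionOfIsColimit hc _ fun n => (hF n).llp⟩
  -- The cokernel of `F₀ → colim F` is the colimit of the cokernels of `F₀ → Fₙ`, each coacyclic
  -- since special morphisms compose; the telescope then applies.
  isCoacyclic_cokernel := IsCoacyclic.of_isColimit (isColimitCokernelCocone hc) fun n => by
    have h (n : ℕ) : IsSpecial (F.map (homOfLE n.zero_le)) := by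
      induction n with
      | zero => exact (F.map_id 0) ▸ IsSpecial.id _
      | succ n hn =>
        have := hn.comp (hF n)
        rw [← F.map_comp] at this
        exact this
    exact (h n).isCoacyclic_cokernel

lemma mono_map_of_forall_succ
    (hF : ∀ n, Mono (F.map (homOfLE (Nat.le_add_right n 1)))) {n m : ℕ} (φ : n ⟶ m) :
    Mono (F.map φ) := by
  obtain ⟨k, rfl⟩ := Nat.exists_eq_add_of_le (leOfHom φ)
  induction k with
  | zero =>
    rw [show φ = 𝟙 n from rfl, F.map_id]
    infer_instance
  | succ k ih =>
    rw [show φ = homOfLE (Nat.le_add_right n k) ≫ homOfLE (Nat.le_add_right (n + k) 1) from rfl,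
      F.map_comp]
    have := ih (homOfLE (Nat.le_add_right n k))
    have := hF (n + k)
    infer_instance

/-- A morphism from a finite module to the colimit of an increasing sequence of modules factors
through some term of the sequence. -/
lemma exists_factor_of_finite {G : ℕ ⥤ ModuleCat.{u} A} {c : Cocone G} (hc : IsColimit c)
    (hG : ∀ n m (φ : n ⟶ m), Mono (G.map φ)) {K : ModuleCat.{u} A} [Module.Finite A K] (f : K ⟶ c.pt) :
    ∃ (n : ℕ) (g : K ⟶ G.obj n), g ≫ c.ι.app n = f := by
  have : PreservesColimitsOfShape ℕ (forget (ModuleCat.{u} A)) := by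
    have := preservesFilteredColimitsOfSize_shrink.{0, u, 0, u} (forget (ModuleCat.{u} A))
    infer_instance
  obtain ⟨t, ht⟩ := Module.Finite.fg_top (R := A) (M := K)
  -- Asking this of all later stages lets the supremum over the finitely many generators serve as a
  -- common stage.
  have h (x : K) : ∃ n, ∀ m, n ≤ m → f x ∈ LinearMap.range (c.ι.app m).hom := by
    obtain ⟨n, y, hy⟩ := Concrete.isColimit_exists_rep G hc (f x)
    refine ⟨n, fun m hm => ⟨(G.map (homOfLE hm)).hom y, ?_⟩⟩
    rw [← hy]
    exact congrArg (fun φ => φ.hom y) (c.w (homOfLE hm))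
  choose n hn using h
  let N := t.sup n
  have hr : LinearMap.range f.hom ≤ LinearMap.range (c.ι.app N).hom := by
    rw [LinearMap.range_eq_map, ← ht, Submodule.map_span, Submodule.span_le]
    rintro _ ⟨x, hx, rfl⟩
    exact hn x N (Finset.le_sup hx)
  have hinj : Function.Injective (c.ι.app N).hom := fun x y hxy => by
    obtain ⟨k, a, b, hab⟩ := Concrete.isColimit_exists_of_rep_eq G hc x y hxy
    obtain rfl : a = b := Subsingleton.elim _ _
    exact (ModuleCat.mono_iff_injective _).1 (hG _ _ a) hab
  let e := LinearEquiv.ofInjective (c.ι.app N).hom hinj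
  let f' : K →ₗ[A] LinearMap.range (c.ι.app N).hom :=
    f.hom.codRestrict _ (fun x => hr ⟨x, rfl⟩)
  refine ⟨N, ModuleCat.ofHom (e.symm.toLinearMap ∘ₗ f'),
    ModuleCat.hom_ext (LinearMap.ext fun x => ?_)⟩
  exact congrArg Subtype.val (e.apply_symm_apply (f' x))

end Sequence

/-! ### Special embeddings into complexes of fp-injective modules -/

section Envelope

variable {A : Type u} [Ring A]

/-- The complexes obtained from a given complex by iteratively solving extension problems. -/
def iterStep (M : Kom A) (n : ℕ) : Kom A :=
  Nat.rec M (fun _ N => step N) n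

/-- The sequence of complexes obtained by iteratively solving extension problems. -/
def stepSequence (M : Kom A) : ℕ ⥤ Kom A :=
  Functor.ofSequence (X := iterStep M) fun n => toStep (iterStep M n)

lemma stepSequence_map (M : Kom A) (n : ℕ) :
    (stepSequence M).map (homOfLE (Nat.le_add_right n 1)) = toStep (iterStep M n) :=
  Functor.ofSequence_map_homOfLE_succ _ n

lemma isSpecial_stepSequence_map (M : Kom A) (n : ℕ) :
    IsSpecial ((stepSequence M).map (homOfLE (Nat.le_add_right n 1))) := by
  rw [stepSequence_map]
  exact isSpecial_toStep _

/-- The source is finitely generated, so the map already lands in some stage `k`, and the problem is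
solved at stage `k + 1`. This is why countably many steps suffice. -/
lemma exists_extension_colimit_stepSequence (M : Kom A) {n : ℤ} (i : FGInclusionIndex A)
    (f : ModuleCat.of A i.2.1 ⟶ (colimit (stepSequence M)).X n) :
    ∃ g, fgInclusion i ≫ g = f := by
  let E := HomologicalComplex.eval (ModuleCat.{u} A) (ComplexShape.up ℤ) n
  have hc := isColimitOfPreserves E (colimit.isColimit (stepSequence M))
  have : Module.Finite A (ModuleCat.of A i.2.1) := Module.Finite.iff_fg.2 i.2.2
  obtain ⟨k, f', hf'⟩ := exists_factor_of_finite hc (fun k l φ => by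
    have := mono_map_of_forall_succ (fun n => (isSpecial_stepSequence_map M n).mono) φ
    exact inferInstanceAs (Mono (E.map ((stepSequence M).map φ)))) f
  obtain ⟨g, hg⟩ : ∃ g : ModuleCat.of A (Fin i.1 → A) ⟶ ((stepSequence M).obj (k + 1)).X n,
      fgInclusion i ≫ g = f' ≫ ((stepSequence M).map (homOfLE (Nat.le_add_right k 1))).f n := by
    rw [stepSequence_map]
    exact exists_extension_toStep (iterStep M k) i f'
  refine ⟨g ≫ (colimit.ι (stepSequence M) (k + 1)).f n, ?_⟩
  rw [reassoc_of% hg, ← hf']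
  exact congrArg (fun φ => f' ≫ φ.f n)
    (colimit.w (stepSequence M) (homOfLE (Nat.le_add_right k 1)))

/-- Any complex of modules admits a special monomorphism to a complex of fp-injective modules. -/
lemma exists_isSpecial (M : Kom A) :
    ∃ (N : Kom A) (f : M ⟶ N), IsSpecial f ∧ ∀ n, IsFPInjective A (N.X n) :=
  ⟨colimit (stepSequence M), colimit.ι (stepSequence M) 0,
    .of_isColimit (colimit.isColimit (stepSequence M)) (isSpecial_stepSequence_map M),
    fun _ => isFPInjective_of_exists_extension (exists_extension_colimit_stepSequence M)⟩

end Envelope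

/-! ### Homotopy classes of maps to complexes of fp-injective modules -/

section Reflection

variable {A : Type u} [Ring A]

open CochainComplex CochainComplex.HomComplex
open scoped ZeroObject

lemma termwiseRlp_zero (hA : IsLeftCoherent A) {F : Kom A} (hF : ∀ n, IsFPInjective A (F.X n)) :
    termwiseRlp A (0 : F ⟶ (0 : Kom A)) := by
  rintro n _ _ _ ⟨i⟩
  refine ⟨fun {a b} sq => ?_⟩
  obtain ⟨g, hg⟩ := (hF n).exists_extension hA i a
  exact ⟨⟨{
    l := g
    fac_left := hg
    fac_right := ((HomologicalComplex.eval _ _ n).map_isZero (isZero_zero _)).eq_of_tgt _ _ }⟩⟩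

/-- This path fibration is in degree `n` the projection `Fⁿ ⊕ Fⁿ⁻¹ → Fⁿ`: the first component of a
lift is prescribed, the second is an extension problem in the fp-injective module `Fⁿ⁻¹`. -/
lemma termwiseRlp_fst (hA : IsLeftCoherent A) {F : Kom A} (hF : ∀ n, IsFPInjective A (F.X n)) :
    termwiseRlp A (mappingCocone.fst (𝟙 F)) := by
  rintro n _ _ _ ⟨i⟩
  refine ⟨fun {a b} sq => ?_⟩
  obtain ⟨g, hg⟩ := (hF (n + -1)).exists_extension hA i (a ≫ (mappingCocone.snd (𝟙 F)).v n _ rfl)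
  refine ⟨⟨{
    l := b ≫ (mappingCocone.inl (𝟙 F)).v n n (add_zero n) +
      g ≫ (mappingCocone.inr (𝟙 F)).1.v (n + -1) n (by lia)
    fac_left := ?_
    fac_right := ?_ }⟩⟩
  · rw [Preadditive.comp_add, reassoc_of% hg, ← reassoc_of% sq.w, ← Preadditive.comp_add,
      mappingCocone.id_X, Category.comp_id]
  · simp

lemma quot_map_eq_zero_of_fac {Y F : Kom A} (l : Y ⟶ mappingCocone (𝟙 F)) :
    (quot A).map (l ≫ mappingCocone.fst (𝟙 F)) = 0 := by
  have h : IsZero ((quot A).obj (mappingCone (𝟙 F))) :=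
    (HomotopyCategory.isZero_quotient_obj_iff _).2 ⟨mappingCone.homotopyToZeroOfId F⟩
  have h' : IsZero ((quot A).obj (mappingCocone (𝟙 F))) :=
    ((CategoryTheory.shiftFunctor (Hot (ModuleCat.{u} A)) (-1 : ℤ)).map_isZero h).of_iso
      (((quot A).commShiftIso (-1 : ℤ)).app (mappingCone (𝟙 F)))
  rw [Functor.map_comp, h'.eq_zero_of_tgt ((quot A).map l), zero_comp]

/-- With `quot_map_eq_zero_of_fac`, null-homotopic maps to `F` are exactly those lifting to the path
complex, so homotopies become lifting problems. -/
lemma exists_lift_of_homotopy {X F : Kom A} (f : X ⟶ F) (h : Homotopy f 0) :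
    ∃ l : X ⟶ mappingCocone (𝟙 F), l ≫ mappingCocone.fst (𝟙 F) = f :=
  ⟨mappingCocone.lift _ f (-Cochain.ofHomotopy h) (by simp), by simp⟩

/-- The morphisms with the left lifting property with respect to `termwiseRlp A` induce
bijections on the morphisms to complexes of fp-injective modules in the homotopy category. -/
lemma bijective_precomp_of_llp (hA : IsLeftCoherent A) {X Y : Kom A} {i : X ⟶ Y}
    (hi : (termwiseRlp A).llp i) {F : Kom A} (hF : ∀ n, IsFPInjective A (F.X n)) :
    Function.Bijective (fun f : (quot A).obj Y ⟶ (quot A).obj F => (quot A).map i ≫ f) := by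
  constructor
  · intro f g hfg
    obtain ⟨f, rfl⟩ := (quot A).map_surjective f
    obtain ⟨g, rfl⟩ := (quot A).map_surjective g
    rw [← sub_eq_zero, ← Functor.map_sub]
    -- Injectivity: a null-homotopy of `i ≫ (f - g)` is a square against the path fibration, and its
    -- diagonal makes `f - g` null-homotopic.
    have h : (quot A).map (i ≫ (f - g)) = (quot A).map 0 := by
      rw [Functor.map_comp, Functor.map_sub, Preadditive.comp_sub, Functor.map_zero, sub_eq_zero]
      exact hfg
    obtain ⟨l, hl⟩ := exists_lift_of_homotopy _ (HomotopyCategory.homotopyOfEq _ _ h)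
    have := hi _ (termwiseRlp_fst hA hF)
    have sq : CommSq l i (mappingCocone.fst (𝟙 F)) (f - g) := ⟨hl⟩
    rw [← sq.fac_right]
    exact quot_map_eq_zero_of_fac _
  · intro f
    obtain ⟨f, rfl⟩ := (quot A).map_surjective f
    have := hi _ (termwiseRlp_zero hA hF)
    have sq : CommSq f i (0 : F ⟶ (0 : Kom A)) 0 := ⟨by simp⟩
    exact ⟨(quot A).map sq.lift, by simp only [← Functor.map_comp, sq.fac_left]⟩

end Reflection

/-! ### Replacing a short exact sequence by one of fp-injective complexes -/

section Horseshoe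

variable {A : Type u} [Ring A]

/-- A short exact sequence of complexes admits a morphism to a short exact sequence of complexes of
fp-injective modules, with components in the left orthogonal of `termwiseRlp A`. -/
lemma exists_shortExact_fpInjective (hA : IsLeftCoherent A) {S : ShortComplex (Kom A)}
    (hS : S.ShortExact) :
    ∃ (S' : ShortComplex (Kom A)) (φ : S ⟶ S'), S'.ShortExact ∧
      (∀ n, IsFPInjective A (S'.X₁.X n)) ∧ (∀ n, IsFPInjective A (S'.X₂.X n)) ∧
      (∀ n, IsFPInjective A (S'.X₃.X n)) ∧
      (termwiseRlp A).llp φ.τ₁ ∧ (termwiseRlp A).llp φ.τ₂ ∧ (termwiseRlp A).llp φ.τ₃ := by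
  have := hS.mono_f
  have := hS.epi_g
  -- Push the sequence out along `S.X₁ ⟶ K`, embed the new middle term in `N`, and push out again
  -- along `q`. The last term is then `N / K`, and each vertical map is special, being a pushout or
  -- a composite of special maps.
  obtain ⟨K, i, hi, hK⟩ := exists_isSpecial S.X₁
  have := hi.mono
  have hj : IsSpecial (pushout.inl S.f i) := .of_isPushout (IsPushout.of_hasPushout _ _) hi
  obtain ⟨N, k, hk, hN⟩ := exists_isSpecial (pushout S.f i)
  have := hk.mono
  let q : pushout S.f i ⟶ S.X₃ := pushout.desc S.g 0 (by simp)
  have hq₁ : pushout.inl S.f i ≫ q = S.g := pushout.inl_desc _ _ _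
  have hq₂ : pushout.inr S.f i ≫ q = 0 := pushout.inr_desc _ _ _
  have : Epi (pushout.inl S.f i ≫ q) := by rw [hq₁]; infer_instance
  have : Epi q := epi_of_epi (pushout.inl S.f i) q
  have hl : IsSpecial (pushout.inl q k) := .of_isPushout (IsPushout.of_hasPushout _ _) hk
  have w : (pushout.inr S.f i ≫ k) ≫ pushout.inr q k = 0 := by
    rw [Category.assoc, ← pushout.condition, reassoc_of% hq₂, zero_comp]
  -- A map out of `N` that kills `K` induces one on `S.X₃`; the pair factors through the second
  -- pushout, which is therefore the cokernel of `K ⟶ N`.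
  let d {Z : Kom A} (f : N ⟶ Z) (hf : (pushout.inr S.f i ≫ k) ≫ f = 0) : S.X₃ ⟶ Z :=
    hS.exact.desc (pushout.inl S.f i ≫ k ≫ f) (by
      rw [pushout.condition_assoc, ← Category.assoc (pushout.inr S.f i), hf, comp_zero])
  have hd {Z : Kom A} (f : N ⟶ Z) (hf : (pushout.inr S.f i ≫ k) ≫ f = 0) : q ≫ d f hf = k ≫ f := by
    apply pushout.hom_ext
    · rw [reassoc_of% hq₁, hS.exact.g_desc]
    · rw [reassoc_of% hq₂, zero_comp, ← Category.assoc, hf]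
  have hc : IsColimit (CokernelCofork.ofπ (pushout.inr q k) w) :=
    CokernelCofork.IsColimit.ofπ _ _ (fun f hf => pushout.desc (d f hf) f (hd f hf))
      (fun f hf => pushout.inr_desc _ _ _)
      (fun f hf m hm => by rw [← cancel_epi (pushout.inr q k), hm, pushout.inr_desc])
  have hS' : (ShortComplex.mk _ _ w).ShortExact :=
    { exact := ShortComplex.exact_of_g_is_cokernel _ hc }
  refine ⟨ShortComplex.mk _ _ w,
    { τ₁ := i
      τ₂ := pushout.inl S.f i ≫ k
      τ₃ := pushout.inl q k
      comm₁₂ := (pushout.condition_assoc k).symm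
      comm₂₃ := by
        dsimp
        rw [Category.assoc, ← pushout.condition, reassoc_of% hq₁] },
    hS', hK, hN, fun n => ?_, hi.llp, (hj.comp hk).llp, hl.llp⟩
  exact IsFPInjective.of_shortExact hA
    (hS'.map_of_exact (HomologicalComplex.eval (ModuleCat.{u} A) (ComplexShape.up ℤ) n))
    (hK n) (hN n)

end Horseshoe

/-! ### The left adjoint of the inclusion of homotopy categories -/

section LeftAdjoint

variable (A : Type u) [Ring A]

/-- The inclusion of the complexes of fp-injective modules in the complexes of modules. -/
abbrev komι : CochainComplex (FPInjectiveModule A) ℤ ⥤ Kom A :=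
  (IsFPInjective A).ι.mapHomologicalComplex (ComplexShape.up ℤ)

/-- The inclusion of the homotopy category of fp-injective modules in the homotopy category of
modules. -/
abbrev hotι : Hot (FPInjectiveModule A) ⥤ Hot (ModuleCat.{u} A) :=
  (IsFPInjective A).ι.mapHomotopyCategory (ComplexShape.up ℤ)

/-- The canonical functor from the complexes of fp-injective modules to their homotopy category. -/
abbrev quotFPI : CochainComplex (FPInjectiveModule A) ℤ ⥤ Hot (FPInjectiveModule A) :=
  HomotopyCategory.quotient (FPInjectiveModule A) (ComplexShape.up ℤ)

variable {A}

lemma exists_komι_obj_eq {N : Kom A} (hN : ∀ n, IsFPInjective A (N.X n)) :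
    ∃ F, (komι A).obj F = N :=
  ⟨HomologicalComplex.liftObjectProperty (IsFPInjective A) N hN, rfl⟩

lemma isFPInjective_komι_obj (F : CochainComplex (FPInjectiveModule A) ℤ) (n : ℤ) :
    IsFPInjective A (((komι A).obj F).X n) :=
  (F.X n).property

lemma bijective_precomp_hotι (hA : IsLeftCoherent A) {X Y : Kom A} {i : X ⟶ Y}
    (hi : (termwiseRlp A).llp i) (G : Hot (FPInjectiveModule A)) :
    Function.Bijective (fun f : (quot A).obj Y ⟶ (hotι A).obj G => (quot A).map i ≫ f) := by
  obtain ⟨G, rfl⟩ := HomotopyCategory.quotient_obj_surjective G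
  exact bijective_precomp_of_llp hA hi (isFPInjective_komι_obj G)

/-- It suffices to find a reflection of each complex separately, and any special embedding into a
termwise fp-injective complex is one. -/
lemma isRightAdjoint_hotι (hA : IsLeftCoherent A) : (hotι A).IsRightAdjoint := by
  refine Functor.isRightAdjoint_of_leftAdjointObjIsDefined_eq_top (top_le_iff.1 fun X _ => ?_)
  obtain ⟨X, rfl⟩ := HomotopyCategory.quotient_obj_surjective X
  obtain ⟨N, i, hi, hN⟩ := exists_isSpecial X
  obtain ⟨F, rfl⟩ := exists_komι_obj_eq hN
  exact ⟨(quotFPI A).obj F, ⟨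
    { homEquiv {G} := (Functor.FullyFaithful.ofFullyFaithful (hotι A)).homEquiv.trans
        (Equiv.ofBijective _ (bijective_precomp_hotι hA hi.llp G))
      homEquiv_comp g f := by
        exact (congrArg ((quot A).map i ≫ ·) ((hotι A).map_comp f g)).trans
          (Category.assoc _ _ _).symm }⟩⟩

variable {L : Hot (ModuleCat.{u} A) ⥤ Hot (FPInjectiveModule A)}

lemma isIso_map_of_llp (adj : L ⊣ hotι A) (hA : IsLeftCoherent A) {X Y : Kom A} {i : X ⟶ Y}
    (hi : (termwiseRlp A).llp i) : IsIso (L.map ((quot A).map i)) := by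
  refine isIso_of_coyoneda_map_bijective _ fun G => ?_
  have h := (bijective_precomp_hotι hA hi G).comp (adj.homEquiv _ G).bijective
  rw [← Function.Bijective.of_comp_iff' (adj.homEquiv _ G).bijective]
  convert h using 2 with f
  ext f
  simp [Adjunction.homEquiv_naturality_left]

/-- In the naturality square of the unit at a special embedding `i`, the unit at the fp-injective
complex and the image of `i` are invertible. So the unit at `X` agrees with `i` up to isomorphism.
-/
lemma trW_unit_app (adj : L ⊣ hotι A) (hA : IsLeftCoherent A) (X : Hot (ModuleCat.{u} A)) :
    (coacyclic (moduleConflations A)).trW (adj.unit.app X) := by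
  obtain ⟨X, rfl⟩ := HomotopyCategory.quotient_obj_surjective X
  obtain ⟨N, i, hi, hN⟩ := exists_isSpecial X
  obtain ⟨F, rfl⟩ := exists_komι_obj_eq hN
  have h₁ := isIso_map_of_llp adj hA hi.llp
  have h₂ : IsIso (adj.unit.app ((quot A).obj ((komι A).obj F))) :=
    inferInstanceAs (IsIso (adj.unit.app ((hotι A).obj ((quotFPI A).obj F))))
  have h₃ : IsIso ((L ⋙ hotι A).map ((quot A).map i)) :=
    inferInstanceAs (IsIso ((hotι A).map (L.map ((quot A).map i))))
  have h := adj.unit.naturality ((quot A).map i)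
  refine (MorphismProperty.cancel_right_of_respectsIso (coacyclic (moduleConflations A)).trW _
    ((L ⋙ hotι A).map ((quot A).map i))).1 ?_
  rw [← h]
  exact (MorphismProperty.cancel_right_of_respectsIso
    (coacyclic (moduleConflations A)).trW _ _).2 hi.trW

lemma coacyclic_map_komι_iff (adj : L ⊣ hotι A) (F : CochainComplex (FPInjectiveModule A) ℤ) :
    coacyclic (fpInjectiveConflations A) (L.obj ((quot A).obj ((komι A).obj F))) ↔
      coacyclic (fpInjectiveConflations A) ((quotFPI A).obj F) :=
  (coacyclic (fpInjectiveConflations A)).prop_iff_of_iso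
    ((asIso adj.counit).app ((quotFPI A).obj F))

lemma coacyclic_map_iff_of_llp (adj : L ⊣ hotι A) (hA : IsLeftCoherent A) {X Y : Kom A} {i : X ⟶ Y}
    (hi : (termwiseRlp A).llp i) :
    coacyclic (fpInjectiveConflations A) (L.obj ((quot A).obj X)) ↔
      coacyclic (fpInjectiveConflations A) (L.obj ((quot A).obj Y)) := by
  have := isIso_map_of_llp adj hA hi
  exact (coacyclic (fpInjectiveConflations A)).prop_iff_of_iso (asIso (L.map ((quot A).map i)))

lemma coacyclic_map_directSum (adj : L ⊣ hotι A) (hA : IsLeftCoherent A) {ι : Type u}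
    (K : ι → Kom A) (c : Cofan K) (hc : IsColimit c)
    (hK : ∀ i, coacyclic (fpInjectiveConflations A) (L.obj ((quot A).obj (K i)))) :
    coacyclic (fpInjectiveConflations A) (L.obj ((quot A).obj c.pt)) := by
  choose N i hi hN using fun j => exists_isSpecial (K j)
  choose F hF using fun j => exists_komι_obj_eq (hN j)
  obtain rfl : (fun j => (komι A).obj (F j)) = N := funext hF
  have : PreservesColimitsOfShape (Discrete ι) (komι A) :=
    HomologicalComplex.preservesColimitsOfShape_of_eval _ (fun n =>
      inferInstanceAs (PreservesColimitsOfShape (Discrete ι)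
        (HomologicalComplex.eval (FPInjectiveModule A) (ComplexShape.up ℤ) n ⋙
          (IsFPInjective A).ι)))
  let c' : Cofan fun j => (komι A).obj (F j) := Cofan.mk _ fun j => (komι A).map (Sigma.ι F j)
  have hc' : IsColimit c' :=
    isColimitCofanMkObjOfIsColimit (komι A) F (Sigma.ι F) (coproductIsCoproduct F)
  let g : c.pt ⟶ c'.pt := Cofan.IsColimit.desc hc fun j => i j ≫ c'.inj j
  -- The left lifting property passes to direct sums of morphisms, which is enough for `L` to invert
  -- `g`.
  have hg : (termwiseRlp A).llp g :=
    MorphismProperty.IsStableUnderColimitsOfShape.condition _ _ c c' hc hc'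
      (Discrete.natTrans fun j => i j.as) (fun j => (hi j.as).llp) g (fun j => by
        exact Cofan.IsColimit.fac hc _ j.as)
  rw [coacyclic_map_iff_of_llp adj hA hg]
  refine (coacyclic_map_komι_iff adj (∐ F)).2
    ((isCoacyclicClass_coacyclic _).directSum_mem F _ (coproductIsCoproduct F) fun j => ?_)
  rw [← coacyclic_map_komι_iff adj, ← coacyclic_map_iff_of_llp adj hA (hi j).llp]
  exact hK j

end LeftAdjoint

/-! ### Descent of the adjunction to the coderived categories -/

section Equivalence

variable {A : Type u} [Ring A]
  {L : Hot (ModuleCat.{u} A) ⥤ Hot (FPInjectiveModule A)} [L.CommShift ℤ] [L.IsTriangulated]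

/-- A triangulated functor which inverts two components of a morphism of arrows inverts the
induced morphism of mapping cones. -/
lemma isIso_map_mappingCone_map {K₁ L₁ K₂ L₂ : Kom A} (φ₁ : K₁ ⟶ L₁) (φ₂ : K₂ ⟶ L₂)
    (a : K₁ ⟶ K₂) (b : L₁ ⟶ L₂) (comm : φ₁ ≫ b = a ≫ φ₂)
    (ha : IsIso (L.map ((quot A).map a))) (hb : IsIso (L.map ((quot A).map b))) :
    IsIso (L.map ((quot A).map (CochainComplex.mappingCone.map φ₁ φ₂ a b comm))) := by
  let T₁ := CochainComplex.mappingCone.triangleh φ₁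
  let T₂ := CochainComplex.mappingCone.triangleh φ₂
  have hT₁ := L.map_distinguished _ (HomotopyCategory.mappingCone_triangleh_distinguished φ₁)
  have hT₂ := L.map_distinguished _ (HomotopyCategory.mappingCone_triangleh_distinguished φ₂)
  let f : T₁ ⟶ T₂ := (quot A).mapTriangle.map
    (CochainComplex.mappingCone.triangleMap φ₁ φ₂ a b comm)
  exact isIso₃_of_isIso₁₂ (L.mapTriangle.map f) hT₁ hT₂ ha hb

lemma isIso_map_totalization_map {S S' : ShortComplex (Kom A)} (φ : S ⟶ S')
    (h₁ : IsIso (L.map ((quot A).map φ.τ₁))) (h₂ : IsIso (L.map ((quot A).map φ.τ₂)))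
    (h₃ : IsIso (L.map ((quot A).map φ.τ₃))) :
    Nonempty (L.obj ((quot A).obj (totalization S)) ≅
      L.obj ((quot A).obj (totalization S'))) := by
  have h := isIso_map_mappingCone_map (L := L) S.f S'.f φ.τ₁ φ.τ₂ φ.comm₁₂.symm h₁ h₂
  have h' := isIso_map_mappingCone_map (L := L) (coneDesc S) (coneDesc S') _ φ.τ₃
    (CochainComplex.mappingCone.map_descShortComplex S S' φ).symm h h₃
  exact ⟨@asIso _ _ _ _ _ h'⟩

/-- A short complex of complexes of fp-injective modules comes from the category of complexes over
the category of fp-injective modules. -/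
lemma exists_shortComplex_map_komι_eq (S : ShortComplex (Kom A))
    (h₁ : ∀ n, IsFPInjective A (S.X₁.X n)) (h₂ : ∀ n, IsFPInjective A (S.X₂.X n))
    (h₃ : ∀ n, IsFPInjective A (S.X₃.X n)) :
    ∃ T : ShortComplex (CochainComplex (FPInjectiveModule A) ℤ), T.map (komι A) = S :=
  ⟨{ X₁ := HomologicalComplex.liftObjectProperty (IsFPInjective A) S.X₁ h₁
     X₂ := HomologicalComplex.liftObjectProperty (IsFPInjective A) S.X₂ h₂
     X₃ := HomologicalComplex.liftObjectProperty (IsFPInjective A) S.X₃ h₃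
     f :=
      { f n := ObjectProperty.homMk (S.f.f n)
        comm' i j _ := InducedCategory.hom_ext (S.f.comm i j) }
     g :=
      { f n := ObjectProperty.homMk (S.g.f n)
        comm' i j _ := InducedCategory.hom_ext (S.g.comm i j) }
     zero := (komι A).map_injective S.zero }, rfl⟩

/-- By minimality of the coacyclic class, this is what shows that `L` preserves coacyclicity. For a
total complex, `L` cannot distinguish the given sequence from its fp-injective replacement, whose
total complex is coacyclic over the fp-injectives. -/
lemma isCoacyclicClass_inverseImage (hA : IsLeftCoherent A) (adj : L ⊣ hotι A) :
    IsCoacyclicClass (moduleConflations A)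
      ((coacyclic (fpInjectiveConflations A)).inverseImage L) where
  isTriangulated := inferInstance
  isClosedUnderIsomorphisms := inferInstance
  directSum_mem K c hc hK := coacyclic_map_directSum adj hA K c hc hK
  totalization_mem S hS := by
    have hS : S.ShortExact := HomologicalComplex.shortExact_of_degreewise_shortExact S hS
    obtain ⟨S', φ, hS', h₁, h₂, h₃, l₁, l₂, l₃⟩ := exists_shortExact_fpInjective hA hS
    obtain ⟨e⟩ := isIso_map_totalization_map φ (isIso_map_of_llp adj hA l₁)
      (isIso_map_of_llp adj hA l₂) (isIso_map_of_llp adj hA l₃)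
    refine (coacyclic (fpInjectiveConflations A)).prop_of_iso e.symm ?_
    obtain ⟨T, rfl⟩ := exists_shortComplex_map_komι_eq S' h₁ h₂ h₃
    have e' := (map_totalization_iso (IsFPInjective A).ι T).some
    exact (coacyclic (fpInjectiveConflations A)).prop_of_iso (L.mapIso e')
      ((coacyclic_map_komι_iff adj _).2
        ((isCoacyclicClass_coacyclic _).totalization_mem T fun n =>
          hS'.map_of_exact (HomologicalComplex.eval (ModuleCat.{u} A) (ComplexShape.up ℤ) n)))

lemma isEquivalence_of_adjunction (hA : IsLeftCoherent A) (adj : L ⊣ hotι A) :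
    (fpInjectiveCoderivedFunctor A).IsEquivalence := by
  have hL : coacyclic (moduleConflations A) ≤
      (coacyclic (fpInjectiveConflations A)).inverseImage L :=
    fun X hX => hX _ (isCoacyclicClass_inverseImage hA adj)
  have : IsIso adj.counit := inferInstance
  let Φ := coderivedLocalizerMorphism (IsFPInjective A).ι (moduleConflations_map_ι A)
  let Ψ : LocalizerMorphism (coacyclic (moduleConflations A)).trW
      (coacyclic (fpInjectiveConflations A)).trW :=
    { functor := L
      map X Y f hf := ((coacyclic (fpInjectiveConflations A)).inverseImage_trW_iff L f).1
        (ObjectProperty.trW_monotone hL _ hf) }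
  -- The criterion takes two transformations out of identity functors, hence the inverse of the
  -- counit, which is invertible as `hotι A` is fully faithful.
  let η := inv adj.counit
  have : Φ.IsLocalizedEquivalence := Φ.isLocalizedEquivalence_of_unit_of_unit Ψ
    η adj.unit (fun X => (coacyclic (fpInjectiveConflations A)).trW.of_isIso (η.app X))
    (trW_unit_app adj hA)
  exact inferInstanceAs (Φ.localizedFunctor _ _).IsEquivalence

end Equivalence

lemma isEquivalence_fpInjectiveCoderivedFunctor (A : Type u) [Ring A] (hA : IsLeftCoherent A) :
    (fpInjectiveCoderivedFunctor A).IsEquivalence := by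
  have := isRightAdjoint_hotι hA
  let adj := Adjunction.ofIsRightAdjoint (hotι A)
  -- A left adjoint of a triangulated functor is itself triangulated.
  let := adj.leftAdjointCommShift ℤ
  have := adj.commShift_of_rightAdjoint ℤ
  have := adj.isTriangulated_leftAdjoint
  exact isEquivalence_of_adjunction hA adj

end Coderived

end

theorem mainTheorem6 (A : Type u) [Ring A] (hA : Coderived.IsLeftCoherent A) :
    (Coderived.fpInjectiveCoderivedFunctor A).IsTriangulated ∧
      (Coderived.fpInjectiveCoderivedFunctor A).IsEquivalence :=
  ⟨inferInstance, Coderived.isEquivalence_fpInjectiveCoderivedFunctor A hA⟩
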